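/- Conventions. For random variables $X_1,\dots,X_r$ with finite moments on one probability space, the mixed cumulant $\kappa(X_1,\dots,X_r)$ is the coefficient of $t_1\cdots t_r$ in the formal power series $\log \mathbb E[\exp(t_1X_1+\dots+t_rX_r)]$. A weighted graph on a finite set $V$ is an assignment of weights in $[0,1]$ to the edges of the complete graph on $V$ (weight $0$ meaning a non-edge); $\mathcal M(H)$ is the maximal weight of a spanning tree of $H$, the weight of a tree being the product of the weights of its edges. Let $\mathbf C=(C_r)_{r\ge1}$ be positive real numbers and let $\Psi$ be a real-valued function on multisets of elements of $V$. A weighted graph $L$ on $V$ is a $(\Psi,\mathbf C)$ weighted dependency graph for a family $(Y_v)_{v\in V}$ of random variables if, for every $r\ge 1$ and every multiset $U=\{v_1,\dots,v_r\}$ of elements of $V$, $$|\kappa(Y_{v_1},\dots,Y_{v_r})|\le C_r\,\Psi(U)\,\mathcal M(L[U]),$$ where $L[U]$ is the weighted graph whose vertices are the elements of $U$, with the same weights as $L$. For a multiset $\alpha=\{(i_1,j_1),\dots,(i_r,j_r)\}$ of elements of $[n]^2$, let $S(\alpha)=\{i_1,\dots,i_r,j_1,\dots,j_r\}$, let $CC(\alpha)$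 be the number of connected components of the graph with vertex set $S(\alpha)$ and edge set $\alpha$, and put $\Psi(\alpha)=n^{CC(\alpha)-\#S(\alpha)}$. Theorem. There is a universal sequence $\mathbf C=(C_r)_{r\ge1}$ of positive real numbers such that the following holds for every $n\ge1$ and every partition $\lambda\vdash n$. Let $\sigma_\lambda$ be a uniform random permutation in the conjugacy class of $S_n$ of cycle type $\lambda$, and let $B_{i,j}=\mathbf 1[\sigma_\lambda(i)=j]$ for $(i,j)\in[n]^2$. Then the complete graph on $[n]^2$, with weight $1/n$ between $(i,j)$ and $(k,\ell)$ if $\{i,j\}$ and $\{k,\ell\}$ are disjoint and weight $1$ otherwise, is a $(\Psi,\mathbf C)$ weighted dependency graph for the family $(B_{i,j})_{(i,j)\in[n]^2}$. Moreover, with the same sequence $\mathbf C$, for every $r\ge1$ and all $i_1,\dots,i_r,j_1,\dots,j_r\in[n]$, $$|\kappa(B_{i_1,j_1},\dots,B_{i_r,j_r})|\le C_r\,n^{1-\#\{i_1,\dots,i_r,j_1,\dots,j_r\}}.$$ -/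

import Mathlib

open MeasureTheory ProbabilityTheory
open scoped Nat

/-! ### Mixed cumulants -/

/-- The formal power series `E[exp (∑ i, t i * X i)]` in the variables `t i`: the coefficient of
`∏ i, t i ^ m i` is `E[∏ i, X i ^ m i] / ∏ i, (m i)!`. -/
noncomputable def momentSeries {Ω ι : Type*} [MeasurableSpace Ω] [Fintype ι]
    (μ : Measure Ω) (X : ι → Ω → ℝ) : MvPowerSeries ι ℝ :=
  fun m => (∫ ω, ∏ i, X i ω ^ m i ∂μ) / ∏ i, ((m i)! : ℝ)

/-- The mixed cumulant of the family `X`: the coefficient of `∏ i, t i` in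
`log E[exp (∑ i, t i * X i)]`. (`PowerSeries.log` is the series of `log (1 + x)`.) -/
noncomputable def mixedCumulant {Ω ι : Type*} [MeasurableSpace Ω] [Fintype ι]
    (μ : Measure Ω) (X : ι → Ω → ℝ) : ℝ :=
  MvPowerSeries.coeff (Finsupp.equivFunOnFinite.symm (fun _ : ι => 1))
    (PowerSeries.subst (momentSeries μ X - 1) (PowerSeries.log ℝ))

/-! ### Weighted graphs and weighted dependency graphs -/

/-- A weighted graph, seen as an assignment of weights in `[0, 1]` to the edges of the complete
graph on `V` (weight `0` encodes a non-edge). The values `weight v v` are irrelevant. -/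
structure WeightedGraph (V : Type*) where
  weight : V → V → ℝ
  symm : ∀ u v, weight u v = weight v u
  nonneg : ∀ u v, 0 ≤ weight u v
  le_one : ∀ u v, weight u v ≤ 1

namespace WeightedGraph

/-- The weighted graph with vertex set `s` and the same weights as `L`. -/
def induce {V : Type*} (L : WeightedGraph V) (s : Finset V) : WeightedGraph s where
  weight u v := L.weight u v
  symm u v := L.symm u v
  nonneg u v := L.nonneg u v
  le_one u v := L.le_one u v

/-- The weight of an unordered pair of vertices. -/
def edgeWeight {V : Type*} (L : WeightedGraph V) : Sym2 V → ℝ :=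
  Sym2.lift ⟨L.weight, L.symm⟩

open Classical in
/-- The maximal weight of a spanning tree of `L`, the weight of a tree being the product of the
weights of its edges. For a nonempty finite `V` this is a maximum over a finite nonempty set. -/
noncomputable def maxSpanningTreeWeight {V : Type*} [Fintype V] (L : WeightedGraph V) : ℝ :=
  ⨆ T : {T : SimpleGraph V // T.IsTree}, ∏ e ∈ T.1.edgeFinset, L.edgeWeight e

end WeightedGraph

/-- `L` is a `(Ψ, C)` weighted dependency graph for the family `Y` of random variables:
`|κ(Y_v ; v ∈ U)| ≤ C_r Ψ(U) M(L[U])` for every `r ≥ 1` and every multiset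
`U = {v_1, …, v_r}` of vertices, where `L[U]` is induced on the elements of `U`. -/
def IsWeightedDependencyGraph {V Ω : Type*} [DecidableEq V] [MeasurableSpace Ω]
    (Ψ : Multiset V → ℝ) (C : ℕ → ℝ) (L : WeightedGraph V) (Y : V → Ω → ℝ)
    (μ : Measure Ω) : Prop :=
  ∀ (r : ℕ), 1 ≤ r → ∀ (v : Fin r → V) (U : Multiset V), U = Finset.univ.val.map v →
    |mixedCumulant μ (fun t => Y (v t))| ≤
      C r * Ψ U * (L.induce U.toFinset).maxSpanningTreeWeight

/-! ### Random permutations in a conjugacy class -/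

/-- Every set of permutations of a finite set is measurable. -/
instance instMeasurableSpacePermFin (n : ℕ) : MeasurableSpace (Equiv.Perm (Fin n)) := ⊤

/-- The permutations of cycle type `lam` (fixed points are counted as parts of size `1`). -/
def cycleTypeClass {n : ℕ} (lam : n.Partition) : Set (Equiv.Perm (Fin n)) :=
  {ρ | ρ.partition.parts = lam.parts}

/-- The random variable `B_{i,j} = 1[σ(i) = j]`, for `p = (i, j)`. -/
def permIndicator {n : ℕ} {Ω : Type*} (σ : Ω → Equiv.Perm (Fin n)) (p : Fin n × Fin n) (ω : Ω) :
    ℝ :=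
  if σ ω p.1 = p.2 then 1 else 0

/-- The support `S(α)`: all first and second coordinates of the elements of `α`. -/
def pairSupport {n : ℕ} (α : Multiset (Fin n × Fin n)) : Finset (Fin n) :=
  α.toFinset.image Prod.fst ∪ α.toFinset.image Prod.snd

/-- The graph with vertex set `S(α)` and edge set `α` (orientation, multiplicity and loops do not
affect connectivity and are dropped). -/
def pairGraph {n : ℕ} (α : Multiset (Fin n × Fin n)) : SimpleGraph (pairSupport α) :=
  SimpleGraph.fromRel fun x y => ((x : Fin n), (y : Fin n)) ∈ α

/-- `CC(α)`, the number of connected components of the graph `(S(α), α)`. -/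
noncomputable def pairCC {n : ℕ} (α : Multiset (Fin n × Fin n)) : ℕ :=
  Nat.card (pairGraph α).ConnectedComponent

/-- `Ψ(α) = n ^ (CC(α) - #S(α))`. -/
noncomputable def pairPsi (n : ℕ) (α : Multiset (Fin n × Fin n)) : ℝ :=
  (n : ℝ) ^ ((pairCC α : ℤ) - ((pairSupport α).card : ℤ))

/-- The complete graph on `[n]²` in which the edge between `(i, j)` and `(k, l)` has weight `1/n`
if `{i, j}` and `{k, l}` are disjoint, and weight `1` otherwise. -/
noncomputable def conjugacyGraph (n : ℕ) : WeightedGraph (Fin n × Fin n) where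
  weight p q := if Disjoint ({p.1, p.2} : Finset (Fin n)) {q.1, q.2} then 1 / (n : ℝ) else 1
  symm p q := by simp only [disjoint_comm]
  nonneg p q := by split_ifs <;> positivity
  le_one p q := by
    split_ifs
    · rcases Nat.eq_zero_or_pos n with h | h
      · simp [h]
      · rw [div_le_one (by exact_mod_cast h)]
        exact_mod_cast h
    · exact le_refl 1

set_option linter.unusedSectionVars false

/-! ### The logarithmic derivative of a formal power series -/

/-! Both assertions reduce to the bound `n ^ (1 - #S)`, where `S` is the set of endpoints of the
pairs `(i t, j t)`. Write `σ = τ⁻¹ρτ` with `ρ` fixed and `τ` a uniform permutation; then `σ (i t) =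
j t` says `τ (j t) = ρ (τ (i t))`. On the endpoints of `T`, `τ` has the law of a uniform map `f`
conditioned to be injective there, so a joint moment is a quotient of two probabilities about
independent values `f x`.

The conditioning is switched on gradually. For a set `Γ` of injectivity constraints, `coupledMoment
Γ T` conditions only on those in `Γ` that concern `T`; `Γ = univ` gives the true moments. Expand
everything by Möbius inversion in `Γ`. For the probabilities, the coefficient at `Γ` is a signed
probability that the edges in question are compatible with `ρ` and the constraints in `Γ` fail.
Along all these edges the values of `f` determine each other, so the coefficient is at most `n ^
(-rank)`, with the rank taken in the graphic matroid (`mobiusBound_coupledProb`). Rank is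
subadditive under union, so such bounds survive products, division by a function that is at least
`1/2`, and the moment-cumulant recursion (`MobiusBound.mul`, `MobiusBound.div`,
`IsCumulant.mobiusBound`).

If the rank for `Γ` is below `#S - 1`, the edges do not connect `S`. By independence the moments for
every `Γ' ⊆ Γ` factor over two groups of indices, the cumulants vanish
(`IsCumulant.eq_zero_of_factor`), and so does the Möbius coefficient at `Γ`. Only coefficients of
size `O(n ^ (1 - #S))` remain, and boundedly many of them. Small `n` is absorbed into the constant.

For the dependency graph, a spanning tree using as many weight-one edges as possible shows that
`Ψ(α) * M(L[α])` is at least `n ^ (1 - #S(α))`. -/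

theorem MvPowerSeries.coeff_subst_eq_coeff_sum {ι : Type*} {G : MvPowerSeries ι ℝ}
    (hG : MvPowerSeries.constantCoeff G = 0) (f : PowerSeries ℝ) {N : ℕ} {e : ι →₀ ℕ}
    (he : e.degree < N) :
    MvPowerSeries.coeff e (PowerSeries.subst G f) =
      MvPowerSeries.coeff e (∑ k ∈ Finset.range N, PowerSeries.coeff k f • G ^ k) := by
  rw [PowerSeries.coeff_subst (PowerSeries.HasSubst.of_constantCoeff_zero hG), map_sum,
    finsum_eq_sum_of_support_subset (s := Finset.range N)]
  · simp
  · intro k hk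
    by_contra hkN
    apply hk
    have h1 : MvPowerSeries.coeff e (G ^ k) = 0 := by
      apply MvPowerSeries.coeff_of_lt_order
      refine lt_of_lt_of_le ?_ (MvPowerSeries.le_order_pow_of_constantCoeff_eq_zero k hG)
      simp only [Finset.coe_range, Set.mem_Iio, not_lt] at hkN
      exact_mod_cast lt_of_lt_of_le he hkN
    simp [h1]

/-- The identity `F ∂(log F) = ∂F` is checked one coefficient at a time: the logarithm is truncated
to a polynomial in `G = F - 1`, whose derivative is a geometric sum times `∂G`. Multiplying by `1 +
G` telescopes, and the remainder has too high an order to contribute. -/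
theorem MvPowerSeries.mul_pderiv_subst_log {ι : Type*} (t : ι) {F : MvPowerSeries ι ℝ}
    (hF : MvPowerSeries.constantCoeff F = 1) :
    F * MvPowerSeries.pderiv ℝ t (PowerSeries.subst (F - 1) (PowerSeries.log ℝ)) =
      MvPowerSeries.pderiv ℝ t F := by
  classical
  obtain ⟨G, rfl⟩ : ∃ G, F = 1 + G := ⟨F - 1, by ring⟩
  have hG : MvPowerSeries.constantCoeff G = 0 := by simpa using hF
  rw [add_sub_cancel_left]
  ext m
  -- The derivative looks one degree higher, at degree `N`, so powers of `G` up to `N` are kept.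
  set N := m.degree + 1 with hN
  set P := ∑ k ∈ Finset.range (N + 1), PowerSeries.coeff k (PowerSeries.log ℝ) • G ^ k with hP
  have h1 : MvPowerSeries.coeff m ((1 + G) * MvPowerSeries.pderiv ℝ t
      (PowerSeries.subst G (PowerSeries.log ℝ))) =
      MvPowerSeries.coeff m ((1 + G) * MvPowerSeries.pderiv ℝ t P) := by
    rw [MvPowerSeries.coeff_mul, MvPowerSeries.coeff_mul]
    refine Finset.sum_congr rfl fun p hp => ?_
    rw [Finset.HasAntidiagonal.mem_antidiagonal] at hp
    have hd : p.1.degree + p.2.degree = m.degree := by rw [← hp, map_add]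
    rw [MvPowerSeries.coeff_pderiv, MvPowerSeries.coeff_pderiv,
      MvPowerSeries.coeff_subst_eq_coeff_sum hG (N := N + 1)]
    rw [map_add, Finsupp.degree_single]
    lia
  have h2 : MvPowerSeries.pderiv ℝ t P =
      (∑ k ∈ Finset.range N, (-G) ^ k) * MvPowerSeries.pderiv ℝ t G := by
    rw [hP, map_sum, Finset.sum_range_succ', Finset.sum_mul]
    have h0 : MvPowerSeries.pderiv ℝ t
        (PowerSeries.coeff 0 (PowerSeries.log ℝ) • G ^ 0) = 0 := by simp
    rw [h0, add_zero]
    refine Finset.sum_congr rfl fun k _ => ?_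
    rw [Derivation.map_smul, MvPowerSeries.pderiv_pow, PowerSeries.coeff_log, if_neg (Nat.succ_ne_zero k),
      Nat.add_sub_cancel, MvPowerSeries.smul_eq_C_mul]
    have hc : ((k + 1 : ℕ) : MvPowerSeries ι ℝ) = MvPowerSeries.C ((k + 1 : ℕ) : ℝ) := by simp
    rw [hc, ← mul_assoc, ← mul_assoc, ← map_mul]
    congr 1
    have hk : ((k + 1 : ℕ) : ℝ) ≠ 0 := by positivity
    have h3 : (algebraMap ℚ ℝ) ((-1) ^ (k + 1 + 1) / ((k + 1 : ℕ) : ℚ)) * ((k + 1 : ℕ) : ℝ)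
        = (-1) ^ k := by
      rw [map_div₀]
      simp only [map_pow, map_neg, map_one, map_natCast]
      rw [div_mul_cancel₀ _ hk]
      ring
    rw [h3, neg_pow G]
    simp
  have h4 : (1 + G) * MvPowerSeries.pderiv ℝ t P =
      MvPowerSeries.pderiv ℝ t G - (-G) ^ N * MvPowerSeries.pderiv ℝ t G := by
    have := mul_neg_geom_sum (-G) N
    rw [sub_neg_eq_add] at this
    rw [h2, ← mul_assoc, this]
    ring
  have h5 : MvPowerSeries.coeff m ((-G) ^ N * MvPowerSeries.pderiv ℝ t G) = 0 := by
    apply MvPowerSeries.coeff_of_lt_order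
    refine lt_of_lt_of_le ?_ MvPowerSeries.le_order_mul
    refine lt_of_lt_of_le ?_ le_self_add
    refine lt_of_lt_of_le ?_
      (MvPowerSeries.le_order_pow_of_constantCoeff_eq_zero N (by simpa using hG))
    exact_mod_cast Nat.lt_succ_self _
  rw [h1, h4, map_sub, h5, sub_zero, map_add, MvPowerSeries.pderiv_one, zero_add]

/-! ### Cumulants of set functions -/

/-- `κ` is the family of cumulants of the moment function `M`, both being indexed by finite sets:
`M T = ∑ κ B * M (T \ B)`, the sum being over the `B ⊆ T` that contain a given `t ∈ T`. -/
def IsCumulant {ι : Type*} [DecidableEq ι] (M κ : Finset ι → ℝ) : Prop :=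
  ∀ T : Finset ι, ∀ t ∈ T,
    M T = ∑ A ∈ (T.erase t).powerset, κ (insert t A) * M (T.erase t \ A)

section IndicatorExponent

variable {ι : Type*} [Fintype ι] [DecidableEq ι]

/-- The exponent of the squarefree monomial `∏ t ∈ T, x t`. -/
noncomputable def indicatorExponent (T : Finset ι) : ι →₀ ℕ :=
  Finsupp.equivFunOnFinite.symm fun t => if t ∈ T then 1 else 0

theorem indicatorExponent_apply (T : Finset ι) (t : ι) :
    indicatorExponent T t = if t ∈ T then 1 else 0 := rfl

theorem indicatorExponent_support (T : Finset ι) : (indicatorExponent T).support = T := by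
  ext t
  simp [indicatorExponent_apply]

theorem indicatorExponent_insert {T : Finset ι} {t : ι} (ht : t ∉ T) :
    indicatorExponent (insert t T) = indicatorExponent T + Finsupp.single t 1 := by
  ext s
  simp only [indicatorExponent_apply, Finsupp.add_apply, Finsupp.single_apply, Finset.mem_insert]
  grind

theorem sum_antidiagonal_indicatorExponent (T : Finset ι) (f : (ι →₀ ℕ) × (ι →₀ ℕ) → ℝ) :
    ∑ p ∈ Finset.HasAntidiagonal.antidiagonal (indicatorExponent T), f p =
      ∑ A ∈ T.powerset, f (indicatorExponent A, indicatorExponent (T \ A)) := by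
  symm
  refine Finset.sum_bij' (fun A _ => (indicatorExponent A, indicatorExponent (T \ A)))
    (fun p _ => p.1.support) ?_ ?_ ?_ ?_ ?_
  · intro A hA
    rw [Finset.mem_powerset] at hA
    rw [Finset.HasAntidiagonal.mem_antidiagonal]
    ext s
    have := @hA s
    simp only [Finsupp.add_apply, indicatorExponent_apply, Finset.mem_sdiff]
    grind
  · intro p hp
    rw [Finset.HasAntidiagonal.mem_antidiagonal] at hp
    rw [Finset.mem_powerset, ← indicatorExponent_support T, ← hp]
    intro s hs
    simp only [Finsupp.mem_support_iff, Finsupp.add_apply] at hs ⊢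
    lia
  · intro A _
    exact indicatorExponent_support A
  · intro p hp
    rw [Finset.HasAntidiagonal.mem_antidiagonal] at hp
    have hs : ∀ s, p.1 s + p.2 s = if s ∈ T then 1 else 0 := fun s => by
      rw [← Finsupp.add_apply, hp, indicatorExponent_apply]
    refine Prod.ext ?_ ?_ <;> ext s <;>
      simp only [indicatorExponent_apply, Finsupp.mem_support_iff, Finset.mem_sdiff] <;>
      have := hs s <;> grind
  · intro A _
    rfl

/-- Compare the coefficients of `F ∂_t(log F) = ∂_t F` at the squarefree monomial of `T.erase t`. -/
theorem isCumulant_log {F : MvPowerSeries ι ℝ} (hF : MvPowerSeries.constantCoeff F = 1) :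
    IsCumulant (fun T => MvPowerSeries.coeff (indicatorExponent T) F)
      (fun T => MvPowerSeries.coeff (indicatorExponent T)
        (PowerSeries.subst (F - 1) (PowerSeries.log ℝ))) := by
  intro T t ht
  have h := congrArg (MvPowerSeries.coeff (indicatorExponent (T.erase t)))
    (MvPowerSeries.mul_pderiv_subst_log t hF)
  have h0 : ∀ A : Finset ι, t ∉ A → ∀ f : MvPowerSeries ι ℝ,
      MvPowerSeries.coeff (indicatorExponent A) (MvPowerSeries.pderiv ℝ t f) =
        MvPowerSeries.coeff (indicatorExponent (insert t A)) f := by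
    intro A hA f
    rw [MvPowerSeries.coeff_pderiv, indicatorExponent_insert hA, indicatorExponent_apply,
      if_neg hA]
    simp
  rw [h0 _ (Finset.notMem_erase t T), Finset.insert_erase ht, mul_comm, MvPowerSeries.coeff_mul,
    sum_antidiagonal_indicatorExponent] at h
  refine h.symm.trans (Finset.sum_congr rfl fun A hA => ?_)
  rw [Finset.mem_powerset] at hA
  simp only [h0 A fun hta => Finset.notMem_erase t T (hA hta)]

end IndicatorExponent

section IsCumulant

variable {ι : Type*} [DecidableEq ι]

/-- Needed for the intermediate `Γ`, where the conditioning depends on `T` and the coupled moments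
are not presented as moments of one family. Only squarefree coefficients matter, so any series
extending `M` serves. -/
theorem exists_isCumulant [Fintype ι] (M : Finset ι → ℝ) (hM : M ∅ = 1) :
    ∃ κ, IsCumulant M κ := by
  let F : MvPowerSeries ι ℝ := fun m => M m.support
  have hF : ∀ m, MvPowerSeries.coeff m F = M m.support := fun m => rfl
  have h0 : MvPowerSeries.constantCoeff F = 1 := by
    rw [← MvPowerSeries.coeff_zero_eq_constantCoeff_apply, hF, Finsupp.support_zero, hM]
  have h := isCumulant_log h0
  simp only [hF, indicatorExponent_support] at h
  exact ⟨_, h⟩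

/-- The recursion for cumulants, solved for the top cumulant. -/
theorem IsCumulant.eq_sub {M κ : Finset ι → ℝ} (h : IsCumulant M κ) (hM : M ∅ = 1)
    {T : Finset ι} {t : ι} (ht : t ∈ T) :
    κ T = M T - ∑ A ∈ (T.erase t).ssubsets, κ (insert t A) * M (T.erase t \ A) := by
  rw [h T t ht, Finset.ssubsets, ← Finset.add_sum_erase _ _ (Finset.mem_powerset_self (T.erase t)),
    Finset.insert_erase ht, Finset.sdiff_self]
  simp [hM]

theorem IsCumulant.unique {M κ κ' : Finset ι → ℝ} (h : IsCumulant M κ) (h' : IsCumulant M κ')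
    (hM : M ∅ = 1) {T : Finset ι} (hT : T.Nonempty) : κ T = κ' T := by
  induction T using Finset.strongInduction with
  | H T ih =>
    obtain ⟨t, ht⟩ := hT
    rw [h.eq_sub hM ht, h'.eq_sub hM ht]
    congr 1
    refine Finset.sum_congr rfl fun A hA => ?_
    rw [Finset.mem_ssubsets] at hA
    rw [ih _ ?_ (Finset.insert_nonempty t A)]
    refine ⟨fun x hx => ?_, fun hh => hA.2 fun x hx => ?_⟩
    · have := hA.1
      grind
    · have := hh (Finset.mem_of_mem_erase hx)
      grind

/-- Joint cumulants of two independent subfamilies vanish. -/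
theorem IsCumulant.eq_zero_of_factor {M κ : Finset ι → ℝ} (h : IsCumulant M κ) (hM : M ∅ = 1)
    (S : Finset ι) (hS : ∀ T, M T = M (T ∩ S) * M (T \ S)) {T : Finset ι}
    (h1 : (T ∩ S).Nonempty) (h2 : (T \ S).Nonempty) : κ T = 0 := by
  induction T using Finset.strongInduction with
  | H T ih =>
    obtain ⟨t, ht⟩ := h1
    have htT : t ∈ T := Finset.mem_of_mem_inter_left ht
    have htS : t ∈ S := Finset.mem_of_mem_inter_right ht
    -- If `A` leaves `S`, then `insert t A` is a smaller set meeting both sides and its cumulant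
    -- vanishes by induction. The remaining terms are the recursion for `T ∩ S` multiplied by `M (T
    -- \ S)`, which already exhausts `M T`.
    have e1 : ∑ A ∈ (T.erase t).ssubsets, κ (insert t A) * M (T.erase t \ A) =
        ∑ A ∈ ((T ∩ S).erase t).powerset, κ (insert t A) * M (T.erase t \ A) := by
      symm
      refine Finset.sum_subset ?_ ?_
      · intro A hA
        rw [Finset.mem_powerset] at hA
        rw [Finset.mem_ssubsets]
        obtain ⟨s, hs⟩ := h2
        refine ⟨fun x hx => ?_, fun hh => ?_⟩
        · have := hA hx
          grind
        · have h3 : s ∈ T.erase t := by grind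
          have := hA (hh h3)
          grind
      · intro A hA hA'
        rw [Finset.mem_ssubsets] at hA
        rw [Finset.mem_powerset, Finset.not_subset] at hA'
        obtain ⟨s, hsA, hs⟩ := hA'
        have hsT := hA.1 hsA
        rw [ih (insert t A), zero_mul]
        · refine ⟨?_, fun hh => hA.2 fun x hx => ?_⟩
          · have := hA.1
            grind
          · have := hh (Finset.mem_of_mem_erase hx)
            grind
        · exact ⟨t, by grind⟩
        · exact ⟨s, by grind⟩
    have e2 : ∑ A ∈ ((T ∩ S).erase t).powerset, κ (insert t A) * M (T.erase t \ A) =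
        M (T ∩ S) * M (T \ S) := by
      rw [h (T ∩ S) t ht, Finset.sum_mul]
      refine Finset.sum_congr rfl fun A hA => ?_
      rw [Finset.mem_powerset] at hA
      rw [hS (T.erase t \ A), mul_assoc]
      have e3 : (T.erase t \ A) ∩ S = (T ∩ S).erase t \ A := by
        clear ih hS h
        ext x
        grind
      have e4 : (T.erase t \ A) \ S = T \ S := by
        clear ih hS h
        ext x
        have := @hA x
        grind
      rw [e3, e4]
    rw [h.eq_sub hM htT, e1, e2, hS T, sub_self]

end IsCumulant

/-! ### Möbius coefficients of functions on a power set -/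

section Mobius

variable {E : Type*} [DecidableEq E]

/-- `c` is the Möbius transform of `u`: `u Γ = ∑ Γ' ⊆ Γ, c Γ'`. -/
def IsMobius (u c : Finset E → ℝ) : Prop :=
  ∀ Γ, u Γ = ∑ Γ' ∈ Γ.powerset, c Γ'

theorem exists_isMobius (u : Finset E → ℝ) : ∃ c, IsMobius u c := by
  refine ⟨fun Γ => Finset.strongInduction
    (fun Γ' f => u Γ' - ∑ Δ ∈ Γ'.ssubsets.attach, f Δ.1 (Finset.mem_ssubsets.1 Δ.2)) Γ, fun Γ => ?_⟩
  rw [← Finset.add_sum_erase _ _ (Finset.mem_powerset_self Γ), Finset.strongInduction_eq,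
    Finset.sum_attach Γ.ssubsets (fun Δ => Finset.strongInduction
      (fun Γ' f => u Γ' - ∑ Δ ∈ Γ'.ssubsets.attach, f Δ.1 (Finset.mem_ssubsets.1 Δ.2)) Δ)]
  exact (sub_add_cancel _ _).symm

theorem IsMobius.eq_sub {u c : Finset E → ℝ} (h : IsMobius u c) (Γ : Finset E) :
    c Γ = u Γ - ∑ Γ' ∈ Γ.ssubsets, c Γ' := by
  rw [h Γ, ← Finset.add_sum_erase _ _ (Finset.mem_powerset_self Γ)]
  exact (add_sub_cancel_right _ _).symm

theorem IsMobius.unique {u c c' : Finset E → ℝ} (h : IsMobius u c) (h' : IsMobius u c')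
    (Γ : Finset E) : c Γ = c' Γ := by
  induction Γ using Finset.strongInduction with
  | H Γ ih =>
    rw [h.eq_sub, h'.eq_sub]
    congr 1
    exact Finset.sum_congr rfl fun Δ hΔ => ih Δ (Finset.mem_ssubsets.1 hΔ)

theorem IsMobius.eq_zero {u c : Finset E → ℝ} (h : IsMobius u c) (Γ : Finset E)
    (hu : ∀ Γ' ⊆ Γ, u Γ' = 0) : c Γ = 0 := by
  induction Γ using Finset.strongInduction with
  | H Γ ih =>
    rw [h.eq_sub, hu Γ subset_rfl, zero_sub, neg_eq_zero]
    refine Finset.sum_eq_zero fun Δ hΔ => ?_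
    rw [Finset.mem_ssubsets] at hΔ
    exact ih Δ hΔ fun Γ' h' => hu Γ' (h'.trans hΔ.1)

/-- The pairs of sets with union `Γ`. -/
def unionPairs (Γ : Finset E) : Finset (Finset E × Finset E) :=
  (Γ.powerset ×ˢ Γ.powerset).filter fun p => p.1 ∪ p.2 = Γ

theorem mem_unionPairs {Γ : Finset E} {p : Finset E × Finset E} :
    p ∈ unionPairs Γ ↔ p.1 ∪ p.2 = Γ := by
  simp only [unionPairs, Finset.mem_filter, Finset.mem_product, Finset.mem_powerset,
    and_iff_right_iff_imp]
  rintro rfl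
  exact ⟨Finset.subset_union_left, Finset.subset_union_right⟩

theorem card_unionPairs_le [Fintype E] (Γ : Finset E) :
    ((unionPairs Γ).card : ℝ) ≤ 4 ^ Fintype.card E := by
  have h : (unionPairs Γ).card ≤ 4 ^ Fintype.card E := by
    refine (Finset.card_filter_le _ _).trans ?_
    rw [Finset.card_product, Finset.card_powerset, ← mul_pow]
    exact Nat.pow_le_pow_right (by norm_num) (Finset.card_le_univ Γ)
  exact_mod_cast h

/-- Expand both factors and group the pairs of subsets by their union. This is why weights are
required to be subadditive under union. -/
theorem IsMobius.mul {u₁ c₁ u₂ c₂ : Finset E → ℝ} (h₁ : IsMobius u₁ c₁) (h₂ : IsMobius u₂ c₂) :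
    IsMobius (fun Γ => u₁ Γ * u₂ Γ) (fun Γ => ∑ p ∈ unionPairs Γ, c₁ p.1 * c₂ p.2) := by
  intro Γ
  dsimp only
  rw [h₁ Γ, h₂ Γ, Finset.sum_mul_sum, ← Finset.sum_product',
    ← Finset.sum_fiberwise_of_maps_to (g := fun p => p.1 ∪ p.2) (t := Γ.powerset)]
  · refine Finset.sum_congr rfl fun Δ hΔ => Finset.sum_congr ?_ fun _ _ => rfl
    rw [Finset.mem_powerset] at hΔ
    ext p
    rw [mem_unionPairs]
    simp only [Finset.mem_filter, Finset.mem_product, Finset.mem_powerset, and_iff_right_iff_imp]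
    rintro rfl
    exact ⟨Finset.subset_union_left.trans hΔ, Finset.subset_union_right.trans hΔ⟩
  · intro p hp
    simp only [Finset.mem_product, Finset.mem_powerset] at hp ⊢
    exact Finset.union_subset hp.1 hp.2

/-- The Möbius coefficients of `u` are bounded by `K * q ^ w Γ`. -/
def MobiusBound (q K : ℝ) (w : Finset E → ℕ) (u : Finset E → ℝ) : Prop :=
  ∃ c, IsMobius u c ∧ ∀ Γ, |c Γ| ≤ K * q ^ w Γ

theorem MobiusBound.mono {q K K' : ℝ} {w : Finset E → ℕ} {u : Finset E → ℝ} (hq : 0 ≤ q)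
    (hK : K ≤ K') (h : MobiusBound q K w u) : MobiusBound q K' w u := by
  obtain ⟨c, hc, hb⟩ := h
  exact ⟨c, hc, fun Γ => (hb Γ).trans (by gcongr)⟩

theorem MobiusBound.sub {q K K' : ℝ} {w : Finset E → ℕ} {u u' : Finset E → ℝ}
    (h : MobiusBound q K w u) (h' : MobiusBound q K' w u') :
    MobiusBound q (K + K') w (fun Γ => u Γ - u' Γ) := by
  obtain ⟨c, hc, hb⟩ := h
  obtain ⟨c', hc', hb'⟩ := h'
  refine ⟨fun Γ => c Γ - c' Γ, fun Γ => ?_, fun Γ => ?_⟩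
  · simp only [hc Γ, hc' Γ, Finset.sum_sub_distrib]
  · rw [add_mul]
    exact (abs_sub _ _).trans (add_le_add (hb Γ) (hb' Γ))

theorem MobiusBound.sum {α : Type*} {q K : ℝ} {w : Finset E → ℕ} (s : Finset α)
    {u : α → Finset E → ℝ} (h : ∀ a ∈ s, MobiusBound q K w (u a)) :
    MobiusBound q (s.card * K) w (fun Γ => ∑ a ∈ s, u a Γ) := by
  classical
  induction s using Finset.induction_on with
  | empty => exact ⟨fun _ => 0, fun Γ => by simp, fun Γ => by simp⟩
  | insert a s ha ih =>
    obtain ⟨c, hc, hb⟩ := h a (Finset.mem_insert_self a s)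
    obtain ⟨c', hc', hb'⟩ := ih fun b hb => h b (Finset.mem_insert_of_mem hb)
    refine ⟨fun Γ => c Γ + c' Γ, fun Γ => ?_, fun Γ => ?_⟩
    · have h1 := hc' Γ
      dsimp only at h1 ⊢
      rw [Finset.sum_insert ha, hc Γ, h1, Finset.sum_add_distrib]
    · rw [Finset.card_insert_of_notMem ha]
      refine (abs_add_le _ _).trans ((add_le_add (hb Γ) (hb' Γ)).trans_eq ?_)
      push_cast
      ring

theorem abs_mul_le_of_weights {q K₁ K₂ a b : ℝ} {m m₁ m₂ : ℕ} (hq : 0 ≤ q) (hq1 : q ≤ 1)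
    (ha : |a| ≤ K₁ * q ^ m₁) (hb : |b| ≤ K₂ * q ^ m₂) (hK₁ : 0 ≤ K₁) (hK₂ : 0 ≤ K₂)
    (hm : m ≤ m₁ + m₂) : |a * b| ≤ K₁ * K₂ * q ^ m := by
  rw [abs_mul]
  calc |a| * |b| ≤ (K₁ * q ^ m₁) * (K₂ * q ^ m₂) := by gcongr
    _ = K₁ * K₂ * q ^ (m₁ + m₂) := by ring
    _ ≤ K₁ * K₂ * q ^ m :=
      mul_le_mul_of_nonneg_left (pow_le_pow_of_le_one hq hq1 hm) (by positivity)

theorem MobiusBound.mul [Fintype E] {q K₁ K₂ : ℝ} {w w₁ w₂ : Finset E → ℕ} {u₁ u₂ : Finset E → ℝ}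
    (hq : 0 ≤ q) (hq1 : q ≤ 1) (hK₁ : 0 ≤ K₁) (hK₂ : 0 ≤ K₂)
    (hw : ∀ Γ₁ Γ₂, w (Γ₁ ∪ Γ₂) ≤ w₁ Γ₁ + w₂ Γ₂)
    (h₁ : MobiusBound q K₁ w₁ u₁) (h₂ : MobiusBound q K₂ w₂ u₂) :
    MobiusBound q (4 ^ Fintype.card E * (K₁ * K₂)) w (fun Γ => u₁ Γ * u₂ Γ) := by
  obtain ⟨c₁, hc₁, hb₁⟩ := h₁
  obtain ⟨c₂, hc₂, hb₂⟩ := h₂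
  refine ⟨_, hc₁.mul hc₂, fun Γ => ?_⟩
  calc |∑ p ∈ unionPairs Γ, c₁ p.1 * c₂ p.2|
      ≤ ∑ p ∈ unionPairs Γ, |c₁ p.1 * c₂ p.2| := Finset.abs_sum_le_sum_abs _ _
    _ ≤ ∑ p ∈ unionPairs Γ, K₁ * K₂ * q ^ w Γ := by
        refine Finset.sum_le_sum fun p hp => ?_
        rw [mem_unionPairs] at hp
        exact abs_mul_le_of_weights hq hq1 (hb₁ _) (hb₂ _) hK₁ hK₂ (hp ▸ hw p.1 p.2)
    _ = (unionPairs Γ).card * (K₁ * K₂ * q ^ w Γ) := by rw [Finset.sum_const, nsmul_eq_mul]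
    _ ≤ 4 ^ Fintype.card E * (K₁ * K₂ * q ^ w Γ) :=
        mul_le_mul_of_nonneg_right (card_unionPairs_le Γ) (by positivity)
    _ = _ := by ring

/-- Division by a function that is bounded below preserves bounds on Möbius coefficients. -/
theorem MobiusBound.div [Fintype E] {q : ℝ} {w w₁ : Finset E → ℕ} {u₁ u : Finset E → ℝ}
    (hq : 0 ≤ q) (hq1 : q ≤ 1) (hw : ∀ Γ₁ Γ₂, w (Γ₁ ∪ Γ₂) ≤ w₁ Γ₁ + w Γ₂)
    (h₁ : MobiusBound q 1 w₁ u₁) (h : MobiusBound q 1 w u) (hu₁ : ∀ Γ, 1 / 2 ≤ u₁ Γ) :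
    MobiusBound q ((3 + 2 * 4 ^ Fintype.card E) ^ (Fintype.card E + 1)) w
      (fun Γ => u Γ / u₁ Γ) := by
  obtain ⟨c₁, hc₁, hb₁⟩ := h₁
  obtain ⟨c, hc, hb⟩ := h
  obtain ⟨d, hd⟩ := exists_isMobius (fun Γ => u Γ / u₁ Γ)
  -- The `2` comes from dividing by `u₁ ≥ 1/2`, and `4 ^ card E` counts the pairs with a given
  -- union.
  set D : ℝ := 3 + 2 * 4 ^ Fintype.card E with hD
  have hP : (0 : ℝ) ≤ 4 ^ Fintype.card E := by positivity
  have hD1 : 1 ≤ D := by linarith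
  have hprod : ∀ Γ, c Γ = ∑ p ∈ unionPairs Γ, c₁ p.1 * d p.2 := by
    refine hc.unique ?_
    convert hc₁.mul hd using 2 with Γ
    rw [mul_div_cancel₀]
    linarith [hu₁ Γ]
  have key : ∀ Γ : Finset E, |d Γ| ≤ D ^ (Γ.card + 1) * q ^ w Γ := by
    intro Γ
    induction Γ using Finset.strongInduction with
    | H Γ ih =>
      have hqw : 0 ≤ q ^ w Γ := by positivity
      -- Pairs with second component `Γ` sum to `u₁ Γ * d Γ`, which isolates `d Γ` with an
      -- invertible factor. The others involve `d` only at proper subsets.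
      set s₁ := (unionPairs Γ).filter fun p => p.2 = Γ with hs₁
      set s₂ := (unionPairs Γ).filter fun p => ¬ p.2 = Γ with hs₂
      have e1 : ∑ p ∈ s₁, c₁ p.1 * d p.2 = u₁ Γ * d Γ := by
        rw [hc₁ Γ, Finset.sum_mul]
        refine Finset.sum_bij' (fun p _ => p.1) (fun Δ _ => (Δ, Γ)) ?_ ?_ ?_ ?_ ?_
        · intro p hp
          rw [hs₁, Finset.mem_filter, mem_unionPairs] at hp
          rw [Finset.mem_powerset, ← hp.1]
          exact Finset.subset_union_left
        · intro Δ hΔ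
          rw [hs₁, Finset.mem_filter, mem_unionPairs]
          exact ⟨Finset.union_eq_right.2 (Finset.mem_powerset.1 hΔ), rfl⟩
        · intro p hp
          rw [hs₁, Finset.mem_filter] at hp
          exact Prod.ext rfl hp.2.symm
        · intro Δ _
          rfl
        · intro p hp
          rw [hs₁, Finset.mem_filter] at hp
          rw [hp.2]
      have e2 : |∑ p ∈ s₂, c₁ p.1 * d p.2| ≤ 4 ^ Fintype.card E * (D ^ Γ.card * q ^ w Γ) := by
        calc |∑ p ∈ s₂, c₁ p.1 * d p.2| ≤ ∑ p ∈ s₂, |c₁ p.1 * d p.2| :=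
              Finset.abs_sum_le_sum_abs _ _
          _ ≤ ∑ p ∈ s₂, D ^ Γ.card * q ^ w Γ := by
              refine Finset.sum_le_sum fun p hp => ?_
              rw [hs₂, Finset.mem_filter, mem_unionPairs] at hp
              have hlt : p.2 ⊂ Γ :=
                lt_of_le_of_ne (by rw [← hp.1]; exact Finset.subset_union_right) hp.2
              have hcard := Finset.card_lt_card hlt
              have h1 := ih p.2 hlt
              have h2 := abs_mul_le_of_weights hq hq1 (hb₁ p.1) h1 zero_le_one
                (by positivity) (hw p.1 p.2)
              rw [hp.1, one_mul] at h2
              refine h2.trans ?_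
              gcongr
              lia
          _ = s₂.card * (D ^ Γ.card * q ^ w Γ) := by rw [Finset.sum_const, nsmul_eq_mul]
          _ ≤ _ := by
              refine mul_le_mul_of_nonneg_right ?_ (by positivity)
              refine le_trans ?_ (card_unionPairs_le Γ)
              exact_mod_cast Finset.card_filter_le _ _
      have e3 : u₁ Γ * d Γ = c Γ - ∑ p ∈ s₂, c₁ p.1 * d p.2 := by
        rw [hprod Γ, ← Finset.sum_filter_add_sum_filter_not (unionPairs Γ) (fun p => p.2 = Γ), e1]
        ring
      have e4 : 1 / 2 * |d Γ| ≤ |u₁ Γ * d Γ| := by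
        rw [abs_mul]
        exact mul_le_mul_of_nonneg_right ((hu₁ Γ).trans (le_abs_self _)) (abs_nonneg _)
      have e5 : |u₁ Γ * d Γ| ≤ 1 * q ^ w Γ + 4 ^ Fintype.card E * (D ^ Γ.card * q ^ w Γ) := by
        rw [e3]
        exact (abs_sub _ _).trans (add_le_add (hb Γ) e2)
      have e6 : (1 : ℝ) ≤ D ^ Γ.card := one_le_pow₀ hD1
      have e7 : q ^ w Γ ≤ D ^ Γ.card * q ^ w Γ := le_mul_of_one_le_left hqw e6
      have e8 : D ^ (Γ.card + 1) * q ^ w Γ =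
          3 * (D ^ Γ.card * q ^ w Γ) +
            2 * (4 ^ Fintype.card E * (D ^ Γ.card * q ^ w Γ)) := by
        rw [pow_succ]
        nth_rewrite 2 [hD]
        ring
      rw [e8]
      linarith
  refine ⟨d, hd, fun Γ => (key Γ).trans ?_⟩
  gcongr
  exact Finset.card_le_univ Γ

/-- Coefficients of weight below `m` vanish by the hypothesis on `u`; each of the others is at most
`K * q ^ m`, and at most `2 ^ card E` are summed. -/
theorem MobiusBound.abs_le [Fintype E] {q K : ℝ} {w : Finset E → ℕ} {u : Finset E → ℝ} {m : ℕ}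
    (hq : 0 ≤ q) (hq1 : q ≤ 1) (hK : 0 ≤ K) (h : MobiusBound q K w u)
    (hu : ∀ Γ, w Γ < m → ∀ Γ' ⊆ Γ, u Γ' = 0) (Γ : Finset E) :
    |u Γ| ≤ 2 ^ Fintype.card E * K * q ^ m := by
  obtain ⟨c, hc, hb⟩ := h
  have h1 : ∀ Δ, |c Δ| ≤ K * q ^ m := by
    intro Δ
    by_cases hΔ : w Δ < m
    · rw [hc.eq_zero Δ (hu Δ hΔ), abs_zero]
      positivity
    · exact (hb Δ).trans
        (mul_le_mul_of_nonneg_left (pow_le_pow_of_le_one hq hq1 (not_lt.1 hΔ)) hK)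
  rw [hc Γ]
  calc |∑ Δ ∈ Γ.powerset, c Δ| ≤ ∑ Δ ∈ Γ.powerset, |c Δ| := Finset.abs_sum_le_sum_abs _ _
    _ ≤ ∑ Δ ∈ Γ.powerset, K * q ^ m := Finset.sum_le_sum fun Δ _ => h1 Δ
    _ = 2 ^ Γ.card * (K * q ^ m) := by
        rw [Finset.sum_const, nsmul_eq_mul, Finset.card_powerset]
        push_cast
        rfl
    _ ≤ 2 ^ Fintype.card E * (K * q ^ m) := by
        gcongr
        · norm_num
        · exact Finset.card_le_univ Γ
    _ = _ := by ring

/-- Bounds on the Möbius coefficients of moments give bounds on those of cumulants. -/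
theorem IsCumulant.mobiusBound {ι : Type*} [DecidableEq ι] [Fintype ι] [Fintype E]
    {M κ : Finset E → Finset ι → ℝ} {q K : ℝ} {w : Finset ι → Finset E → ℕ}
    (hq : 0 ≤ q) (hq1 : q ≤ 1) (hK : 1 ≤ K)
    (hw : ∀ T₁ T₂ Γ₁ Γ₂, w (T₁ ∪ T₂) (Γ₁ ∪ Γ₂) ≤ w T₁ Γ₁ + w T₂ Γ₂)
    (hM : ∀ Γ, M Γ ∅ = 1) (hκ : ∀ Γ, IsCumulant (M Γ) (κ Γ))
    (hb : ∀ T, MobiusBound q K (w T) (fun Γ => M Γ T)) {T : Finset ι} (hT : T.Nonempty) :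
    MobiusBound q ((K + 2 ^ Fintype.card ι * (4 ^ Fintype.card E * K)) ^ T.card) (w T)
      (fun Γ => κ Γ T) := by
  set D : ℝ := K + 2 ^ Fintype.card ι * (4 ^ Fintype.card E * K) with hD
  have hD1 : 1 ≤ D := by
    have : (0 : ℝ) ≤ 2 ^ Fintype.card ι * (4 ^ Fintype.card E * K) := by positivity
    linarith
  induction T using Finset.strongInduction with
  | H T ih =>
    obtain ⟨t, ht⟩ := hT
    have e : (fun Γ => κ Γ T) = fun Γ => M Γ T -
        ∑ A ∈ (T.erase t).ssubsets, κ Γ (insert t A) * M Γ (T.erase t \ A) :=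
      funext fun Γ => (hκ Γ).eq_sub (hM Γ) ht
    rw [e]
    have h1 : MobiusBound q (((T.erase t).ssubsets).card *
        (4 ^ Fintype.card E * (D ^ (T.card - 1) * K))) (w T)
        (fun Γ => ∑ A ∈ (T.erase t).ssubsets, κ Γ (insert t A) * M Γ (T.erase t \ A)) := by
      refine MobiusBound.sum _ fun A hA => ?_
      rw [Finset.mem_ssubsets] at hA
      have hlt : insert t A ⊂ T := by
        refine ⟨fun x hx => ?_, fun hh => hA.2 fun x hx => ?_⟩
        · have := hA.1
          grind
        · have := hh (Finset.mem_of_mem_erase hx)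
          grind
      -- The two index sets cover `T`, so subadditivity of `w` gives each product the full weight `w
      -- T`.
      have hu : insert t A ∪ (T.erase t \ A) = T := by
        have := hA.1
        clear hb hM hκ ih e
        ext x
        grind
      have hcard := Finset.card_lt_card hlt
      refine MobiusBound.mul hq hq1 (by positivity) (by positivity)
        (w₁ := w (insert t A)) (w₂ := w (T.erase t \ A)) ?_ ?_ (hb _)
      · intro Γ₁ Γ₂
        have := hw (insert t A) (T.erase t \ A) Γ₁ Γ₂
        rwa [hu] at this
      · refine (ih _ hlt (Finset.insert_nonempty t A)).mono hq ?_
        exact pow_le_pow_right₀ hD1 (by lia)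
    refine ((hb T).sub h1).mono hq ?_
    have hc0 : 0 < T.card := Finset.card_pos.2 ⟨t, ht⟩
    have hc : (((T.erase t).ssubsets).card : ℝ) ≤ 2 ^ Fintype.card ι := by
      have h2 : ((T.erase t).ssubsets).card ≤ 2 ^ Fintype.card ι := by
        refine (Finset.card_le_card (Finset.erase_subset _ _)).trans ?_
        rw [Finset.card_powerset]
        exact Nat.pow_le_pow_right (by norm_num) (Finset.card_le_univ _)
      exact_mod_cast h2
    have h3 : (1 : ℝ) ≤ D ^ (T.card - 1) := one_le_pow₀ hD1
    calc K + ((T.erase t).ssubsets).card * (4 ^ Fintype.card E * (D ^ (T.card - 1) * K))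
        ≤ D ^ (T.card - 1) * K + 2 ^ Fintype.card ι *
            (4 ^ Fintype.card E * (D ^ (T.card - 1) * K)) := by
          gcongr
          exact le_mul_of_one_le_left (by linarith) h3
      _ = D ^ (T.card - 1) * D := by
          nth_rewrite 3 [hD]
          ring
      _ = D ^ T.card := by
          rw [← pow_succ, Nat.sub_add_cancel hc0]

end Mobius

/-! ### The rank of a set of edges -/

section EdgeRank

variable {V : Type*}

/-- The space of functions that are constant along the edges in `R`. -/
def edgeConst (R : Set (V × V)) : Submodule ℚ (V → ℚ) where
  carrier := {ψ | ∀ p ∈ R, ψ p.1 = ψ p.2}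
  add_mem' h h' p hp := by simp only [Pi.add_apply, h p hp, h' p hp]
  zero_mem' _ _ := rfl
  smul_mem' a ψ h p hp := by simp only [Pi.smul_apply, h p hp]

theorem mem_edgeConst {R : Set (V × V)} {ψ : V → ℚ} :
    ψ ∈ edgeConst R ↔ ∀ p ∈ R, ψ p.1 = ψ p.2 := Iff.rfl

theorem edgeConst_union (R R' : Set (V × V)) :
    edgeConst (R ∪ R') = edgeConst R ⊓ edgeConst R' := by
  ext ψ
  simp only [Submodule.mem_inf, mem_edgeConst, Set.mem_union, or_imp, forall_and]

variable [Fintype V]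

/-- The rank of `R` in the graphic matroid: the number of vertices minus the number of connected
components. -/
noncomputable def edgeRank (R : Set (V × V)) : ℕ :=
  Fintype.card V - Module.finrank ℚ (edgeConst R)

theorem finrank_edgeConst_le (R : Set (V × V)) :
    Module.finrank ℚ (edgeConst R) ≤ Fintype.card V :=
  (Submodule.finrank_le _).trans_eq (Module.finrank_fintype_fun_eq_card ℚ)

theorem edgeRank_add_finrank (R : Set (V × V)) :
    edgeRank R + Module.finrank ℚ (edgeConst R) = Fintype.card V :=
  Nat.sub_add_cancel (finrank_edgeConst_le R)

theorem edgeRank_union_le (R R' : Set (V × V)) :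
    edgeRank (R ∪ R') ≤ edgeRank R + edgeRank R' := by
  have h := Submodule.finrank_sup_add_finrank_inf_eq (edgeConst R) (edgeConst R')
  rw [← edgeConst_union] at h
  have h1 : Module.finrank ℚ (edgeConst R ⊔ edgeConst R' : Submodule ℚ (V → ℚ)) ≤
      Fintype.card V := (Submodule.finrank_le _).trans_eq (Module.finrank_fintype_fun_eq_card ℚ)
  have h2 := edgeRank_add_finrank R
  have h3 := edgeRank_add_finrank R'
  have h4 := edgeRank_add_finrank (R ∪ R')
  lia

theorem edgeRank_pos {R : Set (V × V)} {x y : V} (hxy : x ≠ y) (h : (x, y) ∈ R) :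
    1 ≤ edgeRank R := by
  classical
  have h1 : Module.finrank ℚ (edgeConst R) < Module.finrank ℚ (V → ℚ) := by
    apply Submodule.finrank_lt
    intro htop
    have h2 : Pi.single x (1 : ℚ) ∈ edgeConst R := by rw [htop]; trivial
    have h3 := h2 _ h
    simp [hxy.symm] at h3
  rw [Module.finrank_fintype_fun_eq_card] at h1
  unfold edgeRank
  lia

/-- A space of functions is determined by its values at `finrank`-many points. -/
theorem exists_determining_set (L : Submodule ℚ (V → ℚ)) :
    ∃ X : Finset V, X.card ≤ Module.finrank ℚ L ∧ ∀ ψ ∈ L, (∀ x ∈ X, ψ x = 0) → ψ = 0 := by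
  classical
  let P : Finset V → Prop := fun X => ∀ ψ ∈ L, (∀ x ∈ X, ψ x = 0) → ψ = 0
  have hex : ∃ X, P X := ⟨Finset.univ, fun ψ _ h => funext fun x => h x (Finset.mem_univ x)⟩
  -- For a minimal determining set, each `x ∈ X` has a function in `L` vanishing on the rest of `X`
  -- but not at `x`. These are linearly independent, which bounds `X.card`.
  obtain ⟨X, hX, hmin⟩ := WellFounded.has_min (wellFounded_lt (α := Finset V)) {X | P X} hex
  refine ⟨X, ?_, hX⟩
  have h1 : ∀ x : X, ∃ ψ : L, (∀ y ∈ X, y ≠ x.1 → ψ.1 y = 0) ∧ ψ.1 x.1 ≠ 0 := by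
    intro x
    by_contra! hcon
    refine hmin (X.erase x.1) (fun ψ hps h => hX ψ hps fun y hy => ?_) (Finset.erase_ssubset x.2)
    have h2 := hcon ⟨ψ, hps⟩ fun y hy hyx => h y (Finset.mem_erase.2 ⟨hyx, hy⟩)
    by_cases hyx : y = x.1
    · rw [hyx]
      exact h2
    · exact h y (Finset.mem_erase.2 ⟨hyx, hy⟩)
  choose ψ hps0 hps1 using h1
  have hli : LinearIndependent ℚ ψ := by
    rw [Fintype.linearIndependent_iff]
    intro g hg x
    have h2 : (∑ y, g y • ψ y).1 x.1 = 0 := by rw [hg]; rfl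
    rw [Submodule.coe_sum, Finset.sum_apply, Finset.sum_eq_single x] at h2
    · exact (mul_eq_zero.1 h2).resolve_right (hps1 x)
    · intro y _ hyx
      have := hps0 y x.1 x.2 fun h => hyx (Subtype.ext h.symm)
      simp [this]
    · simp
  simpa using hli.fintype_card_le_finrank

/-- Maps whose coincidence sets are unions of connected components are determined by one value
on each component. -/
theorem card_le_pow_finrank {X : Type*} [Fintype X] [DecidableEq X] (R : Set (V × V))
    (F : Finset (V → X))
    (hF : ∀ f ∈ F, ∀ g ∈ F, ∀ p ∈ R, (f p.1 = g p.1 ↔ f p.2 = g p.2)) :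
    F.card ≤ Fintype.card X ^ Module.finrank ℚ (edgeConst R) := by
  classical
  rcases F.eq_empty_or_nonempty with rfl | ⟨f₀, hf₀⟩
  · simp
  obtain ⟨Y, hY, hdet⟩ := exists_determining_set (edgeConst R)
  have hinj : Set.InjOn (fun (f : V → X) (y : Y) => f y.1) F := by
    intro f hf g hg hfg
    -- The indicator of disagreement is constant along `R`, hence is determined by its values on
    -- `Y`.
    have h1 : (fun v => if f v = g v then (0 : ℚ) else 1) = 0 := by
      refine hdet _ (fun p hp => ?_) fun y hy => ?_
      · simp only [hF f hf g hg p hp]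
      · exact if_pos (congrFun hfg ⟨y, hy⟩)
    funext v
    by_contra hv
    have := congrFun h1 v
    simp [hv] at this
  have h2 : F.card ≤ Fintype.card (Y → X) :=
    (Finset.card_le_card_of_injOn _ (fun _ _ => Finset.mem_univ _) hinj).trans_eq
      (Finset.card_univ)
  rw [Fintype.card_fun, Fintype.card_coe] at h2
  by_cases hX : Fintype.card X = 0
  · have hXe : IsEmpty X := Fintype.card_eq_zero_iff.1 hX
    have hVe : IsEmpty V := ⟨fun v => hXe.elim (f₀ v)⟩
    have hY0 : Y.card = 0 := by rw [Finset.eq_empty_of_isEmpty Y, Finset.card_empty]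
    have h3 : Module.finrank ℚ (edgeConst R) = 0 := by
      have := finrank_edgeConst_le R
      rwa [Fintype.card_eq_zero, Nat.le_zero] at this
    rw [h3]
    rwa [hY0] at h2
  · exact h2.trans (Nat.pow_le_pow_right (Nat.pos_of_ne_zero hX) hY)

/-- If the rank of `R` is too small for `S` to be connected, then some function that is constant
along the edges of `R` separates two points of `S`. -/
theorem exists_separating_of_edgeRank_lt {R : Set (V × V)} {S : Finset V}
    (h : edgeRank R < S.card - 1) :
    ∃ ψ ∈ edgeConst R, ∃ x ∈ S, ∃ y ∈ S, ψ x ≠ ψ y := by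
  classical
  by_contra! hcon
  have hne : S.Nonempty := by
    rw [← Finset.card_pos]
    lia
  obtain ⟨x₀, hx₀⟩ := hne
  -- If every function constant along `R` is constant on `S`, then its values outside `S.erase x₀`
  -- determine it, so the dimension is at most `card V - (S.card - 1)`.
  let Y := {x : V // x ∉ S.erase x₀}
  let r : edgeConst R →ₗ[ℚ] (Y → ℚ) :=
    (LinearMap.funLeft ℚ ℚ (Subtype.val : Y → V)).comp (edgeConst R).subtype
  have hr : Function.Injective r := by
    rw [← LinearMap.ker_eq_bot, LinearMap.ker_eq_bot']
    rintro ⟨ψ, hps⟩ h0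
    ext x
    have h1 : ∀ y : Y, ψ y.1 = 0 := fun y => congrFun h0 y
    by_cases hx : x ∈ S
    · have h2 := hcon ψ hps x hx x₀ hx₀
      exact h2.trans (h1 ⟨x₀, Finset.notMem_erase x₀ S⟩)
    · exact h1 ⟨x, fun hx' => hx (Finset.mem_of_mem_erase hx')⟩
  have h2 := LinearMap.finrank_le_finrank_of_injective hr
  rw [Module.finrank_fintype_fun_eq_card, Fintype.card_subtype_compl, Fintype.card_coe,
    Finset.card_erase_of_mem hx₀] at h2
  have h3 := edgeRank_add_finrank R
  have h4 := Finset.card_le_univ S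
  lia

end EdgeRank

/-! ### Moments of a random map with coupled injectivity constraints -/

section Coupled

variable {V : Type*} [Fintype V] [DecidableEq V]

/-- The average of `F` over all maps `V → V`. -/
noncomputable def mapAverage (F : (V → V) → ℝ) : ℝ :=
  (∑ f, F f) / (Fintype.card V : ℝ) ^ Fintype.card V

theorem card_pow_card_pos [Nonempty V] : (0 : ℝ) < (Fintype.card V : ℝ) ^ Fintype.card V := by
  have : (0 : ℝ) < Fintype.card V := by exact_mod_cast Fintype.card_pos
  positivity

theorem mapAverage_const [Nonempty V] (a : ℝ) : mapAverage (fun _ : V → V => a) = a := by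
  have h := card_pow_card_pos (V := V)
  rw [mapAverage, Finset.sum_const, Finset.card_univ, Fintype.card_fun, nsmul_eq_mul]
  push_cast
  field_simp

theorem mapAverage_mono {F G : (V → V) → ℝ} (h : ∀ f, F f ≤ G f) :
    mapAverage F ≤ mapAverage G :=
  div_le_div_of_nonneg_right (Finset.sum_le_sum fun f _ => h f) (by positivity)

theorem mapAverage_sub (F G : (V → V) → ℝ) :
    mapAverage (fun f => F f - G f) = mapAverage F - mapAverage G := by
  simp only [mapAverage, Finset.sum_sub_distrib, sub_div]

theorem mapAverage_sum {α : Type*} (s : Finset α) (F : α → (V → V) → ℝ) :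
    mapAverage (fun f => ∑ a ∈ s, F a f) = ∑ a ∈ s, mapAverage (F a) := by
  simp only [mapAverage]
  rw [Finset.sum_comm, Finset.sum_div]

theorem abs_mapAverage_le (F : (V → V) → ℝ) : |mapAverage F| ≤ mapAverage fun f => |F f| := by
  have h : (0 : ℝ) ≤ (Fintype.card V : ℝ) ^ Fintype.card V := by positivity
  rw [mapAverage, abs_div, abs_of_nonneg h]
  exact div_le_div_of_nonneg_right (Finset.abs_sum_le_sum_abs _ _) h

/-- Functions of the restrictions of a uniform random map to disjoint sets are independent. -/
theorem mapAverage_mul [Nonempty V] (W : Finset V) {F G : (V → V) → ℝ}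
    (hF : ∀ f g, (∀ x ∈ W, f x = g x) → F f = F g) (hG : ∀ f g, (∀ x ∉ W, f x = g x) → G f = G g) :
    mapAverage (fun f => F f * G f) = mapAverage F * mapAverage G := by
  have h := card_pow_card_pos (V := V)
  have h1 : (∑ f : V → V, F f) * ∑ f, G f =
      (Fintype.card V : ℝ) ^ Fintype.card V * ∑ f, F f * G f := by
    rw [Finset.sum_mul_sum, ← Finset.sum_product']
    -- Two independent copies exchange their values outside `W`; this involution turns `F p.1 * G
    -- p.2` into a function of one copy.
    let s : (V → V) × (V → V) → (V → V) × (V → V) :=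
      fun p => (W.piecewise p.1 p.2, W.piecewise p.2 p.1)
    have hs : Function.Involutive s := by
      intro p
      refine Prod.ext ?_ ?_ <;> funext x <;> by_cases hx : x ∈ W <;> simp [s, hx]
    have h2 : ∑ p ∈ Finset.univ ×ˢ Finset.univ, F p.1 * G p.2 =
        ∑ p : (V → V) × (V → V), F p.1 * G p.1 := by
      rw [Finset.univ_product_univ]
      refine Fintype.sum_equiv hs.toPerm _ _ fun p => ?_
      congr 1
      · exact hF _ _ fun x hx => by simp [s, hx]
      · exact hG _ _ fun x hx => by simp [s, hx]
    rw [h2, Fintype.sum_prod_type]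
    simp only [Finset.sum_const, Finset.card_univ, Fintype.card_fun, nsmul_eq_mul]
    rw [← Finset.mul_sum]
    push_cast
    rfl
  simp only [mapAverage]
  rw [div_mul_div_comm, h1]
  field_simp

/-- The probability that a uniform random map lies in `F` is controlled by the rank of a set of
edges along which the elements of `F` determine each other. -/
theorem card_div_le_pow_edgeRank [Nonempty V] (R : Set (V × V)) (F : Finset (V → V))
    (hF : ∀ f ∈ F, ∀ g ∈ F, ∀ p ∈ R, (f p.1 = g p.1 ↔ f p.2 = g p.2)) :
    (F.card : ℝ) / (Fintype.card V : ℝ) ^ Fintype.card V ≤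
      (1 / (Fintype.card V : ℝ)) ^ edgeRank R := by
  have hV : (0 : ℝ) < Fintype.card V := by exact_mod_cast Fintype.card_pos
  rw [div_le_iff₀ (card_pow_card_pos (V := V))]
  have h1 : (F.card : ℝ) ≤ (Fintype.card V : ℝ) ^ Module.finrank ℚ (edgeConst R) := by
    exact_mod_cast card_le_pow_finrank R F hF
  refine h1.trans_eq ?_
  have h2 : (Fintype.card V : ℝ) ^ Fintype.card V = (Fintype.card V : ℝ) ^ edgeRank R *
      (Fintype.card V : ℝ) ^ Module.finrank ℚ (edgeConst R) := by
    rw [← pow_add, edgeRank_add_finrank]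
  rw [h2, ← mul_assoc, ← mul_pow, one_div_mul_cancel hV.ne', one_pow, one_mul]

variable {ι : Type*} [Fintype ι] [DecidableEq ι] (i j : ι → V) (ρ : Equiv.Perm V)

/-- The endpoints of the edges `(i t, j t)`, as a family indexed by `ι × Bool`. -/
def endpoint (a : ι × Bool) : V := if a.2 then j a.1 else i a.1

/-- The index set of the injectivity constraints: pairs of endpoints. -/
abbrev Constraint (ι : Type*) := (ι × Bool) × (ι × Bool)

/-- The constraint `e` is active for the edges in `T`, and violated by `f`. -/
def Violates (T : Finset ι) (e : Constraint ι) (f : V → V) : Prop :=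
  e.1.1 ∈ T ∧ e.2.1 ∈ T ∧ endpoint i j e.1 ≠ endpoint i j e.2 ∧
    f (endpoint i j e.1) = f (endpoint i j e.2)

instance (T : Finset ι) (e : Constraint ι) (f : V → V) : Decidable (Violates i j T e f) := by
  unfold Violates
  infer_instance

/-- The indicator of the violation of `e`. -/
def violation (T : Finset ι) (e : Constraint ι) (f : V → V) : ℝ :=
  if Violates i j T e f then 1 else 0

/-- The indicator that `f` maps the edges in `T` to edges of `ρ`. -/
def edgeCompat (T : Finset ι) (f : V → V) : ℝ :=
  ∏ t ∈ T, if f (j t) = ρ (f (i t)) then 1 else 0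

/-- The probability that a uniform random map satisfies the constraints in `Γ` that are active for
`T`, and maps the edges in `T₀` to edges of `ρ`. -/
noncomputable def coupledProb (Γ : Finset (Constraint ι)) (T T₀ : Finset ι) : ℝ :=
  mapAverage fun f => edgeCompat i j ρ T₀ f * ∏ e ∈ Γ, (1 - violation i j T e f)

/-- The edges `(i t, j t)` for `t ∈ T`, and those joining the endpoints in `Γ`. -/
def constraintEdges (T : Finset ι) (Γ : Finset (Constraint ι)) : Set (V × V) :=
  (fun t => (i t, j t)) '' T ∪ (fun e : Constraint ι => (endpoint i j e.1, endpoint i j e.2)) '' Γ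

theorem constraintEdges_union (T₁ T₂ : Finset ι) (Γ₁ Γ₂ : Finset (Constraint ι)) :
    constraintEdges i j (T₁ ∪ T₂) (Γ₁ ∪ Γ₂) =
      constraintEdges i j T₁ Γ₁ ∪ constraintEdges i j T₂ Γ₂ := by
  simp only [constraintEdges, Finset.coe_union, Set.image_union]
  exact Set.union_union_union_comm _ _ _ _

theorem edgeRank_constraintEdges_union_le (T₁ T₂ : Finset ι) (Γ₁ Γ₂ : Finset (Constraint ι)) :
    edgeRank (constraintEdges i j (T₁ ∪ T₂) (Γ₁ ∪ Γ₂)) ≤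
      edgeRank (constraintEdges i j T₁ Γ₁) + edgeRank (constraintEdges i j T₂ Γ₂) := by
  rw [constraintEdges_union]
  exact edgeRank_union_le _ _

theorem violation_nonneg (T : Finset ι) (e : Constraint ι) (f : V → V) :
    0 ≤ violation i j T e f := by
  unfold violation
  split_ifs <;> norm_num

theorem violation_le_one (T : Finset ι) (e : Constraint ι) (f : V → V) :
    violation i j T e f ≤ 1 := by
  unfold violation
  split_ifs <;> norm_num

theorem edgeCompat_eq (T : Finset ι) (f : V → V) :
    edgeCompat i j ρ T f = if ∀ t ∈ T, f (j t) = ρ (f (i t)) then 1 else 0 := by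
  rw [edgeCompat, Finset.prod_boole]
  congr

/-- Expanding `∏ (1 - violation)` over subsets exhibits the Möbius coefficients. The weight involves
only `T₀`, since `T` merely decides which constraints are active. -/
theorem mobiusBound_coupledProb [Nonempty V] (T T₀ : Finset ι) :
    MobiusBound (1 / (Fintype.card V : ℝ)) 1 (fun Γ => edgeRank (constraintEdges i j T₀ Γ))
      (fun Γ => coupledProb i j ρ Γ T T₀) := by
  classical
  refine ⟨fun Γ => mapAverage fun f => edgeCompat i j ρ T₀ f * ∏ e ∈ Γ, -violation i j T e f,
    fun Γ => ?_, fun Γ => ?_⟩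
  · rw [← mapAverage_sum]
    simp only [coupledProb]
    congr 1
    funext f
    simp only [sub_eq_add_neg]
    rw [Finset.prod_one_add, Finset.mul_sum]
  · rw [one_mul]
    -- Dropping the activity and distinctness requirements of a violation only enlarges the event.
    let F : Finset (V → V) := Finset.univ.filter fun f =>
      (∀ t ∈ T₀, f (j t) = ρ (f (i t))) ∧
        ∀ e ∈ Γ, f (endpoint i j e.1) = f (endpoint i j e.2)
    refine le_trans ?_ (card_div_le_pow_edgeRank (constraintEdges i j T₀ Γ) F ?_)
    · refine (abs_mapAverage_le _).trans ?_
      have hF : (F.card : ℝ) / (Fintype.card V : ℝ) ^ Fintype.card V =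
          mapAverage fun f => if f ∈ F then 1 else 0 := by
        simp [mapAverage]
      rw [hF]
      refine mapAverage_mono fun f => ?_
      rw [abs_mul, Finset.abs_prod, edgeCompat_eq]
      simp only [abs_neg]
      have h2 : ∏ e ∈ Γ, |violation i j T e f| ≤ 1 :=
        Finset.prod_le_one (fun _ _ => abs_nonneg _) fun e _ => by
          rw [abs_of_nonneg (violation_nonneg i j T e f)]
          exact violation_le_one i j T e f
      by_cases hf : f ∈ F
      · rw [if_pos hf]
        split_ifs <;> simp [h2]
      · rw [if_neg hf]
        by_cases h3 : ∀ t ∈ T₀, f (j t) = ρ (f (i t))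
        · have h4 : ¬ ∀ e ∈ Γ, f (endpoint i j e.1) = f (endpoint i j e.2) := fun h4 =>
            hf (Finset.mem_filter.2 ⟨Finset.mem_univ f, h3, h4⟩)
          push Not at h4
          obtain ⟨e, he, hne⟩ := h4
          rw [Finset.prod_eq_zero he, mul_zero]
          have h5 : ¬ Violates i j T e f := fun h5 => hne h5.2.2.2
          rw [violation, if_neg h5, abs_zero]
        · rw [if_neg h3, abs_zero, zero_mul]
    · intro f hf g hg p hp
      have hf' := (Finset.mem_filter.1 hf).2
      have hg' := (Finset.mem_filter.1 hg).2
      rcases hp with ⟨t, ht, rfl⟩ | ⟨e, he, rfl⟩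
      · dsimp only
        rw [hf'.1 t ht, hg'.1 t ht, ρ.injective.eq_iff]
      · dsimp only
        rw [hf'.2 e he, hg'.2 e he]

theorem prod_one_sub_ge {α : Type*} (s : Finset α) (a : α → ℝ) (h0 : ∀ x ∈ s, 0 ≤ a x)
    (h1 : ∀ x ∈ s, a x ≤ 1) : 1 - ∑ x ∈ s, a x ≤ ∏ x ∈ s, (1 - a x) := by
  classical
  induction s using Finset.induction_on with
  | empty => simp
  | insert x s hx ih =>
    rw [Finset.sum_insert hx, Finset.prod_insert hx]
    have h2 := ih (fun y hy => h0 y (Finset.mem_insert_of_mem hy))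
      fun y hy => h1 y (Finset.mem_insert_of_mem hy)
    have h3 : ∏ y ∈ s, (1 - a y) ≤ 1 :=
      Finset.prod_le_one (fun y hy => by linarith [h1 y (Finset.mem_insert_of_mem hy)])
        fun y hy => by linarith [h0 y (Finset.mem_insert_of_mem hy)]
    nlinarith [h0 x (Finset.mem_insert_self x s)]

theorem mapAverage_violation_le [Nonempty V] (T : Finset ι) (e : Constraint ι) :
    mapAverage (violation i j T e) ≤ 1 / (Fintype.card V : ℝ) := by
  by_cases he : endpoint i j e.1 = endpoint i j e.2
  · have h : violation i j T e = fun _ => 0 := by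
      funext f
      exact if_neg fun h => h.2.2.1 he
    rw [h, mapAverage_const]
    positivity
  · let R : Set (V × V) := {(endpoint i j e.1, endpoint i j e.2)}
    let F : Finset (V → V) := Finset.univ.filter fun f =>
      f (endpoint i j e.1) = f (endpoint i j e.2)
    have h1 := card_div_le_pow_edgeRank R F fun f hf g hg p hp => by
      rw [Set.mem_singleton_iff.1 hp]
      dsimp only
      rw [(Finset.mem_filter.1 hf).2, (Finset.mem_filter.1 hg).2]
    have h2 : mapAverage (violation i j T e) ≤
        (F.card : ℝ) / (Fintype.card V : ℝ) ^ Fintype.card V := by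
      have hF : (F.card : ℝ) / (Fintype.card V : ℝ) ^ Fintype.card V =
          mapAverage fun f => if f ∈ F then 1 else 0 := by
        simp [mapAverage]
      rw [hF]
      refine mapAverage_mono fun f => ?_
      unfold violation
      split_ifs with h3 h4
      · exact le_rfl
      · exact absurd (Finset.mem_filter.2 ⟨Finset.mem_univ f, h3.2.2.2⟩) h4
      · norm_num
      · norm_num
    refine h2.trans (h1.trans ?_)
    have hV : (1 : ℝ) ≤ Fintype.card V := by exact_mod_cast Fintype.card_pos
    refine (pow_le_pow_of_le_one (by positivity) ?_
      (edgeRank_pos he (Set.mem_singleton _))).trans_eq (pow_one _)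
    rw [div_le_one (by linarith)]
    exact hV

/-- Union bound: each constraint fails with probability at most `1 / card V`. -/
theorem half_le_coupledProb [Nonempty V]
    (hV : 2 * Fintype.card (Constraint ι) ≤ Fintype.card V) (Γ : Finset (Constraint ι))
    (T : Finset ι) : 1 / 2 ≤ coupledProb i j ρ Γ T ∅ := by
  have hV0 : (0 : ℝ) < Fintype.card V := by exact_mod_cast Fintype.card_pos
  have h1 : mapAverage (fun f => 1 - ∑ e ∈ Γ, violation i j T e f) ≤
      coupledProb i j ρ Γ T ∅ := by
    refine mapAverage_mono fun f => ?_
    rw [edgeCompat, Finset.prod_empty, one_mul]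
    exact prod_one_sub_ge _ _ (fun e _ => violation_nonneg i j T e f)
      fun e _ => violation_le_one i j T e f
  rw [mapAverage_sub, mapAverage_const, mapAverage_sum] at h1
  have h2 : ∑ e ∈ Γ, mapAverage (violation i j T e) ≤ 1 / 2 := by
    calc ∑ e ∈ Γ, mapAverage (violation i j T e)
        ≤ ∑ e ∈ Γ, 1 / (Fintype.card V : ℝ) :=
          Finset.sum_le_sum fun e _ => mapAverage_violation_le i j T e
      _ = Γ.card * (1 / (Fintype.card V : ℝ)) := by rw [Finset.sum_const, nsmul_eq_mul]
      _ ≤ Fintype.card (Constraint ι) * (1 / (Fintype.card V : ℝ)) := by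
          gcongr
          exact Finset.card_le_univ Γ
      _ ≤ 1 / 2 := by
          rw [mul_one_div, div_le_div_iff₀ hV0 (by norm_num)]
          have : (2 * Fintype.card (Constraint ι) : ℝ) ≤ Fintype.card V := by exact_mod_cast hV
          linarith
  have h3 : (∑ e ∈ Γ, mapAverage fun f => violation i j T e f) ≤ 1 / 2 := h2
  linarith

/-- The coupled moments: the conditional probability that a uniform random map sends the edges in
`T` to edges of `ρ`, given that it satisfies the constraints in `Γ` that are active for `T`. -/
noncomputable def coupledMoment (Γ : Finset (Constraint ι)) (T : Finset ι) : ℝ :=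
  coupledProb i j ρ Γ T T / coupledProb i j ρ Γ T ∅

theorem coupledMoment_empty [Nonempty V] (Γ : Finset (Constraint ι)) :
    coupledMoment i j ρ Γ ∅ = 1 := by
  have h : coupledProb i j ρ Γ ∅ ∅ = 1 := by
    refine Eq.trans ?_ (mapAverage_const (V := V) 1)
    unfold coupledProb
    congr 1
    funext f
    rw [edgeCompat, Finset.prod_empty, one_mul]
    refine Finset.prod_eq_one fun e _ => ?_
    rw [violation, if_neg fun h => Finset.notMem_empty _ h.1, sub_zero]
  rw [coupledMoment, h, div_one]

/-- The constant in the bounds on the Möbius coefficients of `coupledMoment`. -/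
noncomputable def momentConst (e : ℕ) : ℝ := (3 + 2 * 4 ^ e) ^ (e + 1)

theorem one_le_momentConst (e : ℕ) : 1 ≤ momentConst e := by
  refine one_le_pow₀ ?_
  have : (0 : ℝ) ≤ 4 ^ e := by positivity
  linarith

theorem one_div_card_le_one [Nonempty V] : 1 / (Fintype.card V : ℝ) ≤ 1 := by
  have hV : (1 : ℝ) ≤ Fintype.card V := by exact_mod_cast Fintype.card_pos
  rw [div_le_one (by linarith)]
  exact hV

/-- The denominator carries no compatibility condition, so its weight is the rank for `T₀ = ∅`;
together with the weight of the numerator it dominates the rank of the union. -/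
theorem mobiusBound_coupledMoment [Nonempty V]
    (hV : 2 * Fintype.card (Constraint ι) ≤ Fintype.card V) (T : Finset ι) :
    MobiusBound (1 / (Fintype.card V : ℝ)) (momentConst (Fintype.card (Constraint ι)))
      (fun Γ => edgeRank (constraintEdges i j T Γ)) (fun Γ => coupledMoment i j ρ Γ T) := by
  refine MobiusBound.div (by positivity) one_div_card_le_one ?_
    (mobiusBound_coupledProb i j ρ T ∅) (mobiusBound_coupledProb i j ρ T T)
    fun Γ => half_le_coupledProb i j ρ hV Γ T
  intro Γ₁ Γ₂
  have := edgeRank_constraintEdges_union_le i j ∅ T Γ₁ Γ₂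
  rwa [Finset.empty_union] at this

/-! ### Factorization over level sets of a function constant along the edges -/

section Factor

variable {i j} {Γ : Finset (Constraint ι)} {ψ : V → ℚ}
  (hps : ψ ∈ edgeConst (constraintEdges i j Finset.univ Γ)) (a : ℚ)

include hps

theorem apply_endpoint (b : ι × Bool) : ψ (endpoint i j b) = ψ (i b.1) := by
  have h : ψ (i b.1) = ψ (j b.1) :=
    hps (i b.1, j b.1) (Or.inl ⟨b.1, Finset.mem_coe.2 (Finset.mem_univ _), rfl⟩)
  unfold endpoint
  split_ifs
  · exact h.symm
  · rfl

/-- The coupled probabilities factorize over unions of connected components. -/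
theorem coupledProb_factor [Nonempty V] (T T₀ : Finset ι) :
    coupledProb i j ρ Γ T T₀ =
      coupledProb i j ρ Γ (T ∩ Finset.univ.filter fun t => ψ (i t) = a)
          (T₀ ∩ Finset.univ.filter fun t => ψ (i t) = a) *
        coupledProb i j ρ Γ (T \ Finset.univ.filter fun t => ψ (i t) = a)
          (T₀ \ Finset.univ.filter fun t => ψ (i t) = a) := by
  classical
  set S := Finset.univ.filter fun t => ψ (i t) = a with hS
  have hmem : ∀ t, t ∈ S ↔ ψ (i t) = a := fun t => by simp [hS]
  have hend : ∀ b : ι × Bool, ψ (endpoint i j b) = a ↔ b.1 ∈ S := fun b => by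
    rw [apply_endpoint hps, hmem]
  -- No constraint of `Γ` joins the two sides, so each is active for at most one of `T ∩ S` and `T \
  -- S`.
  have hedge : ∀ e ∈ Γ, (e.1.1 ∈ S ↔ e.2.1 ∈ S) := by
    intro e he
    rw [← hend, ← hend, hps (endpoint i j e.1, endpoint i j e.2)
      (Or.inr ⟨e, Finset.mem_coe.2 he, rfl⟩)]
  unfold coupledProb
  rw [← mapAverage_mul (Finset.univ.filter fun x => ψ x = a)]
  · congr 1
    funext f
    have h1 : edgeCompat i j ρ T₀ f = edgeCompat i j ρ (T₀ ∩ S) f * edgeCompat i j ρ (T₀ \ S) f :=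
      (Finset.prod_inter_mul_prod_sdiff T₀ S _).symm
    have h2 : ∏ e ∈ Γ, (1 - violation i j T e f) =
        (∏ e ∈ Γ, (1 - violation i j (T ∩ S) e f)) *
          ∏ e ∈ Γ, (1 - violation i j (T \ S) e f) := by
      rw [← Finset.prod_mul_distrib]
      refine Finset.prod_congr rfl fun e he => ?_
      have h3 := hedge e he
      unfold violation Violates
      simp only [Finset.mem_inter, Finset.mem_sdiff]
      by_cases h4 : e.1.1 ∈ S
      · simp [h4, h3.1 h4]
      · have h5 : e.2.1 ∉ S := mt h3.2 h4
        simp [h4, h5]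
    rw [h1, h2]
    ring
  · intro f g hfg
    have hfg' : ∀ b : ι × Bool, b.1 ∈ S → f (endpoint i j b) = g (endpoint i j b) :=
      fun b hb => hfg _ (by simpa using (hend b).2 hb)
    congr 1
    · refine Finset.prod_congr rfl fun t ht => ?_
      have htS := Finset.mem_of_mem_inter_right ht
      have h1 := hfg' (t, true) htS
      have h2 := hfg' (t, false) htS
      simp only [endpoint, if_true, Bool.false_eq_true, if_false] at h1 h2
      rw [h1, h2]
    · refine Finset.prod_congr rfl fun e _ => ?_
      congr 1
      unfold violation Violates
      refine if_congr ?_ rfl rfl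
      refine and_congr_right fun h1 => and_congr_right fun h2 => ?_
      rw [hfg' _ (Finset.mem_of_mem_inter_right h1), hfg' _ (Finset.mem_of_mem_inter_right h2)]
  · intro f g hfg
    have hfg' : ∀ b : ι × Bool, b.1 ∉ S → f (endpoint i j b) = g (endpoint i j b) :=
      fun b hb => hfg _ (by simpa using fun h => hb ((hend b).1 h))
    congr 1
    · refine Finset.prod_congr rfl fun t ht => ?_
      have htS := (Finset.mem_sdiff.1 ht).2
      have h1 := hfg' (t, true) htS
      have h2 := hfg' (t, false) htS
      simp only [endpoint, if_true, Bool.false_eq_true, if_false] at h1 h2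
      rw [h1, h2]
    · refine Finset.prod_congr rfl fun e _ => ?_
      congr 1
      unfold violation Violates
      refine if_congr ?_ rfl rfl
      refine and_congr_right fun h1 => and_congr_right fun h2 => ?_
      rw [hfg' _ (Finset.mem_sdiff.1 h1).2, hfg' _ (Finset.mem_sdiff.1 h2).2]

theorem coupledMoment_factor [Nonempty V] (T : Finset ι) :
    coupledMoment i j ρ Γ T =
      coupledMoment i j ρ Γ (T ∩ Finset.univ.filter fun t => ψ (i t) = a) *
        coupledMoment i j ρ Γ (T \ Finset.univ.filter fun t => ψ (i t) = a) := by
  unfold coupledMoment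
  rw [coupledProb_factor ρ hps a T T, coupledProb_factor ρ hps a T ∅, div_mul_div_comm,
    Finset.empty_inter, Finset.empty_sdiff]

end Factor

/-- The cumulants of the coupled moments decay with the number of vertices. -/
theorem abs_coupledCumulant_le [Nonempty V] [Nonempty ι]
    (hV : 2 * Fintype.card (Constraint ι) ≤ Fintype.card V)
    {κ : Finset (Constraint ι) → Finset ι → ℝ}
    (hκ : ∀ Γ, IsCumulant (coupledMoment i j ρ Γ) (κ Γ)) (Γ : Finset (Constraint ι)) :
    |κ Γ Finset.univ| ≤ 2 ^ Fintype.card (Constraint ι) *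
      (momentConst (Fintype.card (Constraint ι)) +
        2 ^ Fintype.card ι * (4 ^ Fintype.card (Constraint ι) *
          momentConst (Fintype.card (Constraint ι)))) ^ Fintype.card ι *
      (1 / (Fintype.card V : ℝ)) ^
        ((Finset.univ.image i ∪ Finset.univ.image j).card - 1) := by
  have h1 := one_le_momentConst (Fintype.card (Constraint ι))
  have hq : (0 : ℝ) ≤ 1 / (Fintype.card V : ℝ) := by positivity
  refine MobiusBound.abs_le (w := fun Γ => edgeRank (constraintEdges i j Finset.univ Γ))
    (u := fun Γ => κ Γ Finset.univ) hq one_div_card_le_one (by positivity) ?_ ?_ Γ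
  · exact IsCumulant.mobiusBound (M := coupledMoment i j ρ)
      (w := fun T Γ => edgeRank (constraintEdges i j T Γ)) hq one_div_card_le_one h1
      (edgeRank_constraintEdges_union_le i j) (coupledMoment_empty i j ρ) hκ
      (mobiusBound_coupledMoment i j ρ hV) Finset.univ_nonempty
  · intro Γ hΓ Γ' hΓ'
    obtain ⟨ψ, hps, x, hx, y, hy, hxy⟩ := exists_separating_of_edgeRank_lt hΓ
    -- Fewer constraints mean fewer edges, so one separating `ψ` serves all `Γ' ⊆ Γ`.
    have hps' : ψ ∈ edgeConst (constraintEdges i j Finset.univ Γ') := by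
      intro p hp
      refine hps p ?_
      rcases hp with hp | ⟨e, he, rfl⟩
      · exact Or.inl hp
      · exact Or.inr ⟨e, Finset.mem_coe.2 (hΓ' he), rfl⟩
    have hend : ∀ z ∈ Finset.univ.image i ∪ Finset.univ.image j, ∃ t, ψ (i t) = ψ z := by
      intro z hz
      rw [Finset.mem_union, Finset.mem_image, Finset.mem_image] at hz
      rcases hz with ⟨t, _, rfl⟩ | ⟨t, _, rfl⟩
      · exact ⟨t, rfl⟩
      · exact ⟨t, (apply_endpoint hps' (t, true)).symm⟩
    obtain ⟨s, hs⟩ := hend x hx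
    obtain ⟨t, ht⟩ := hend y hy
    refine (hκ Γ').eq_zero_of_factor (coupledMoment_empty i j ρ Γ') _
      (coupledMoment_factor ρ hps' (ψ x)) ⟨s, ?_⟩ ⟨t, ?_⟩
    · simp [hs]
    · simp [ht, hxy.symm]

end Coupled

/-! ### Averages over permutations -/

section Average

variable {V : Type*} [Fintype V] [DecidableEq V]

theorem exists_perm_eqOn {f : V → V} {S : Finset V} (hf : Set.InjOn f S) :
    ∃ g : Equiv.Perm V, ∀ x ∈ S, g x = f x := by
  obtain ⟨g, hg⟩ := Finset.exists_equiv_extend_of_card_eq (t := Finset.univ) (α := V)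
    (Finset.card_univ).symm (s := S) (f := f) (Finset.subset_univ _) hf
  exact ⟨g.trans (Equiv.subtypeUnivEquiv Finset.mem_univ), hg⟩

/-- A uniform random map conditioned on being injective on `S` has, on `S`, the law of a uniform
random permutation. -/
theorem factorial_mul_sum_injOn (S : Finset V) (P : (V → V) → ℝ)
    (hP : ∀ f g : V → V, (∀ x ∈ S, f x = g x) → P f = P g) :
    ((Fintype.card V)! : ℝ) * ∑ f ∈ Finset.univ.filter (fun f : V → V => Set.InjOn f S), P f =
      (Finset.univ.filter (fun f : V → V => Set.InjOn f S)).card * ∑ τ : Equiv.Perm V, P τ := by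
  set F := Finset.univ.filter (fun f : V → V => Set.InjOn f S) with hF
  -- Double counting of `P (τ ∘ f)`: left composition permutes `F`, while for fixed `f` one may
  -- replace `f` by a permutation `g` agreeing with it on `S` and absorb `g` into `τ`.
  have h1 : ∀ τ : Equiv.Perm V, ∑ f ∈ F, P (τ ∘ f) = ∑ f ∈ F, P f := by
    intro τ
    refine Finset.sum_bij' (fun f _ => τ ∘ f) (fun f _ => τ.symm ∘ f) ?_ ?_ ?_ ?_ ?_
    · intro f hf
      rw [hF, Finset.mem_filter] at hf ⊢
      exact ⟨Finset.mem_univ _, τ.injective.comp_injOn hf.2⟩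
    · intro f hf
      rw [hF, Finset.mem_filter] at hf ⊢
      exact ⟨Finset.mem_univ _, τ.symm.injective.comp_injOn hf.2⟩
    · intro f _
      funext x
      simp
    · intro f _
      funext x
      simp
    · intro f _
      rfl
  have h2 : ∀ f ∈ F, ∑ τ : Equiv.Perm V, P (τ ∘ f) = ∑ τ : Equiv.Perm V, P τ := by
    intro f hf
    obtain ⟨g, hg⟩ := exists_perm_eqOn (Finset.mem_filter.1 hf).2
    refine Fintype.sum_equiv (Equiv.mulRight g) _ _ fun τ => hP _ _ fun x hx => ?_
    simp [hg x hx]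
  calc ((Fintype.card V)! : ℝ) * ∑ f ∈ F, P f
      = ∑ τ : Equiv.Perm V, ∑ f ∈ F, P (τ ∘ f) := by
        simp only [h1]
        rw [Finset.sum_const, Finset.card_univ, Fintype.card_perm, nsmul_eq_mul]
    _ = ∑ f ∈ F, ∑ τ : Equiv.Perm V, P (τ ∘ f) := Finset.sum_comm
    _ = ∑ f ∈ F, ∑ τ : Equiv.Perm V, P τ := Finset.sum_congr rfl h2
    _ = F.card * ∑ τ : Equiv.Perm V, P τ := by rw [Finset.sum_const, nsmul_eq_mul]

variable {ι : Type*} [Fintype ι] [DecidableEq ι] (i j : ι → V) (ρ : Equiv.Perm V)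

theorem prod_one_sub_violation_univ (T : Finset ι) (f : V → V) :
    ∏ e : Constraint ι, (1 - violation i j T e f) =
      if Set.InjOn f (T.image i ∪ T.image j : Finset V) then 1 else 0 := by
  have hmem : ∀ b : ι × Bool, b.1 ∈ T → endpoint i j b ∈ T.image i ∪ T.image j := by
    rintro ⟨t, b⟩ ht
    unfold endpoint
    split_ifs
    · exact Finset.mem_union_right _ (Finset.mem_image_of_mem j ht)
    · exact Finset.mem_union_left _ (Finset.mem_image_of_mem i ht)
  have hex : ∀ x ∈ T.image i ∪ T.image j, ∃ b : ι × Bool, b.1 ∈ T ∧ endpoint i j b = x := by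
    intro x hx
    rw [Finset.mem_union, Finset.mem_image, Finset.mem_image] at hx
    rcases hx with ⟨t, ht, rfl⟩ | ⟨t, ht, rfl⟩
    · exact ⟨(t, false), ht, rfl⟩
    · exact ⟨(t, true), ht, rfl⟩
  split_ifs with h
  · refine Finset.prod_eq_one fun e _ => ?_
    rw [violation, if_neg, sub_zero]
    rintro ⟨h1, h2, h3, h4⟩
    exact h3 (h (hmem _ h1) (hmem _ h2) h4)
  · unfold Set.InjOn at h
    push Not at h
    obtain ⟨x, hx, y, hy, hxy, hne⟩ := h
    obtain ⟨a, ha, rfl⟩ := hex x hx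
    obtain ⟨b, hb, rfl⟩ := hex y hy
    refine Finset.prod_eq_zero (Finset.mem_univ (a, b)) ?_
    rw [violation, if_pos ⟨ha, hb, hne, hxy⟩, sub_self]

theorem coupledProb_univ (T T₀ : Finset ι) :
    coupledProb i j ρ Finset.univ T T₀ =
      (∑ f ∈ Finset.univ.filter (fun f : V → V =>
        Set.InjOn f (T.image i ∪ T.image j : Finset V)), edgeCompat i j ρ T₀ f) /
        (Fintype.card V : ℝ) ^ Fintype.card V := by
  unfold coupledProb mapAverage
  simp only [prod_one_sub_violation_univ, mul_ite, mul_one, mul_zero]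
  rw [Finset.sum_filter]

/-- With all constraints, the coupled moments are probabilities for a uniform permutation. -/
theorem coupledMoment_univ [Nonempty V] (T : Finset ι) :
    coupledMoment i j ρ Finset.univ T =
      (∑ τ : Equiv.Perm V, edgeCompat i j ρ T τ) / ((Fintype.card V)! : ℝ) := by
  have h0 := card_pow_card_pos (V := V)
  have h1 := factorial_mul_sum_injOn (T.image i ∪ T.image j) (edgeCompat i j ρ T) (by
    intro f g hfg
    refine Finset.prod_congr rfl fun t ht => ?_
    rw [hfg _ (Finset.mem_union_left _ (Finset.mem_image_of_mem i ht)),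
      hfg _ (Finset.mem_union_right _ (Finset.mem_image_of_mem j ht))])
  have h2 : (0 : ℝ) < (Finset.univ.filter (fun f : V → V =>
      Set.InjOn f (T.image i ∪ T.image j : Finset V))).card := by
    have : (Finset.univ.filter (fun f : V → V =>
      Set.InjOn f (T.image i ∪ T.image j : Finset V))).Nonempty :=
      ⟨id, Finset.mem_filter.2 ⟨Finset.mem_univ _, Set.injOn_id _⟩⟩
    exact_mod_cast Finset.card_pos.2 this
  have h3 : (0 : ℝ) < ((Fintype.card V)! : ℝ) := by exact_mod_cast Nat.factorial_pos _
  unfold coupledMoment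
  rw [coupledProb_univ, coupledProb_univ]
  simp only [edgeCompat, Finset.prod_empty] at h1 ⊢
  rw [div_div_div_cancel_right₀ h0.ne', Finset.sum_const, nsmul_eq_mul, mul_one,
    div_eq_div_iff h2.ne' h3.ne']
  linarith

/-- A uniform element of a conjugacy class is a uniform conjugate of a fixed element. -/
theorem card_mul_sum_conj (s : Finset (Equiv.Perm V))
    (hs : ∀ σ, σ ∈ s ↔ IsConj ρ σ) (Q : Equiv.Perm V → ℝ) :
    (s.card : ℝ) * ∑ τ : Equiv.Perm V, Q (τ⁻¹ * ρ * τ) =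
      ((Fintype.card V)! : ℝ) * ∑ σ ∈ s, Q σ := by
  have h1 : ∀ τ : Equiv.Perm V, ∑ σ ∈ s, Q (τ⁻¹ * σ * τ) = ∑ σ ∈ s, Q σ := by
    intro τ
    refine Finset.sum_bij' (fun σ _ => τ⁻¹ * σ * τ) (fun σ _ => τ * σ * τ⁻¹) ?_ ?_ ?_ ?_ ?_
    · intro σ hσ
      rw [hs] at hσ ⊢
      exact hσ.trans (isConj_iff.2 ⟨τ⁻¹, by group⟩)
    · intro σ hσ
      rw [hs] at hσ ⊢
      exact hσ.trans (isConj_iff.2 ⟨τ, rfl⟩)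
    · intro σ _
      group
    · intro σ _
      group
    · intro σ _
      rfl
  have h2 : ∀ σ ∈ s, ∑ τ : Equiv.Perm V, Q (τ⁻¹ * σ * τ) =
      ∑ τ : Equiv.Perm V, Q (τ⁻¹ * ρ * τ) := by
    intro σ hσ
    obtain ⟨c, hc⟩ := isConj_iff.1 ((hs σ).1 hσ)
    refine Fintype.sum_equiv (Equiv.mulLeft c⁻¹) _ _ fun τ => ?_
    rw [← hc, Equiv.coe_mulLeft]
    exact congrArg Q (by group)
  calc (s.card : ℝ) * ∑ τ : Equiv.Perm V, Q (τ⁻¹ * ρ * τ)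
      = ∑ σ ∈ s, ∑ τ : Equiv.Perm V, Q (τ⁻¹ * σ * τ) := by
        rw [Finset.sum_congr rfl h2, Finset.sum_const, nsmul_eq_mul]
    _ = ∑ τ : Equiv.Perm V, ∑ σ ∈ s, Q (τ⁻¹ * σ * τ) := Finset.sum_comm
    _ = ((Fintype.card V)! : ℝ) * ∑ σ ∈ s, Q σ := by
        simp only [h1]
        rw [Finset.sum_const, Finset.card_univ, Fintype.card_perm, nsmul_eq_mul]

end Average

/-! ### Mixed cumulants of permutation indicators -/

section Cumulant

theorem mixedCumulant_isCumulant {Ω ι : Type*} [MeasurableSpace Ω] [Fintype ι] [DecidableEq ι]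
    (μ : Measure Ω) [IsProbabilityMeasure μ] (X : ι → Ω → ℝ) :
    ∃ κ : Finset ι → ℝ, IsCumulant (fun T => ∫ ω, ∏ t ∈ T, X t ω ∂μ) κ ∧
      κ Finset.univ = mixedCumulant μ X := by
  have hF : MvPowerSeries.constantCoeff (momentSeries μ X) = 1 := by
    rw [← MvPowerSeries.coeff_zero_eq_constantCoeff_apply]
    change momentSeries μ X 0 = 1
    simp [momentSeries]
  have h := isCumulant_log hF
  have hcoeff : ∀ T : Finset ι,
      MvPowerSeries.coeff (indicatorExponent T) (momentSeries μ X) = ∫ ω, ∏ t ∈ T, X t ω ∂μ := by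
    intro T
    change momentSeries μ X (indicatorExponent T) = _
    unfold momentSeries
    have h1 : ∏ t, ((indicatorExponent T t)! : ℝ) = 1 := by
      refine Finset.prod_eq_one fun t _ => ?_
      rw [indicatorExponent_apply]
      split_ifs <;> simp
    rw [h1, div_one]
    congr 1
    funext ω
    simp only [indicatorExponent_apply, pow_ite, pow_one, pow_zero]
    rw [Finset.prod_ite_mem, Finset.univ_inter]
  simp only [hcoeff] at h
  refine ⟨_, h, ?_⟩
  unfold mixedCumulant
  congr 2
  ext t
  simp [indicatorExponent_apply]

/-- A bound for cumulants of variables whose mixed moments are at most `1`. -/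
theorem IsCumulant.abs_le {ι : Type*} [Fintype ι] [DecidableEq ι] [Nonempty ι]
    {M κ : Finset ι → ℝ} (h : IsCumulant M κ) (hM : M ∅ = 1) (hb : ∀ T, |M T| ≤ 1) :
    |κ Finset.univ| ≤ (1 + 2 ^ Fintype.card ι) ^ Fintype.card ι := by
  -- With no constraints, weight `0` and `q = 1`, the Möbius estimate becomes a plain bound on
  -- cumulants.
  have h1 := IsCumulant.mobiusBound (E := Empty) (M := fun _ => M) (κ := fun _ => κ) (q := 1)
    (K := 1) (w := fun _ _ => 0) zero_le_one le_rfl le_rfl (fun _ _ _ _ => le_rfl) (fun _ => hM)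
    (fun _ => h) (fun T => ⟨fun _ => M T, fun Γ => by
      rw [Finset.eq_empty_of_isEmpty Γ, Finset.powerset_empty, Finset.sum_singleton],
      fun Γ => by simpa using hb T⟩) (T := Finset.univ) Finset.univ_nonempty
  have h2 := h1.abs_le (m := 0) zero_le_one le_rfl (by positivity)
    (fun _ h => absurd h (lt_irrefl 0)) ∅
  simpa using h2

variable {n : ℕ} {Ω : Type*} [MeasurableSpace Ω] {μ : Measure Ω} [IsProbabilityMeasure μ]
  {lam : n.Partition} {σ : Ω → Equiv.Perm (Fin n)}

theorem cycleTypeClass_nonempty (hσ : HasLaw σ (uniformOn (cycleTypeClass lam)) μ) :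
    (cycleTypeClass lam).Nonempty := by
  by_contra h
  rw [Set.not_nonempty_iff_eq_empty] at h
  have h1 := hσ.isProbabilityMeasure_iff.1 inferInstance
  rw [h, uniformOn_empty_meas] at h1
  exact h1.ne_zero _ rfl

theorem mem_cycleTypeClass_iff_isConj {ρ τ : Equiv.Perm (Fin n)} (hρ : ρ ∈ cycleTypeClass lam) :
    τ ∈ cycleTypeClass lam ↔ IsConj ρ τ := by
  have hρ' : ρ.partition.parts = lam.parts := hρ
  rw [Equiv.Perm.partition_eq_of_isConj, Nat.Partition.ext_iff, hρ', eq_comm]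
  rfl

/-- A uniform element of the class is `τ⁻¹ρτ` with `τ` uniform, and `τ⁻¹ρτ` sends `i t` to `j t`
exactly when `τ (j t) = ρ (τ (i t))`. -/
theorem integral_prod_permIndicator {ι : Type*} [Fintype ι] [DecidableEq ι]
    (hσ : HasLaw σ (uniformOn (cycleTypeClass lam)) μ) {ρ : Equiv.Perm (Fin n)}
    (hρ : ρ ∈ cycleTypeClass lam) (i j : ι → Fin n) (T : Finset ι) :
    ∫ ω, ∏ t ∈ T, permIndicator σ (i t, j t) ω ∂μ =
      (∑ τ : Equiv.Perm (Fin n), edgeCompat i j ρ T τ) / ((Fintype.card (Fin n))! : ℝ) := by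
  classical
  set Q : Equiv.Perm (Fin n) → ℝ := fun π => ∏ t ∈ T, if π (i t) = j t then 1 else 0 with hQ
  set s : Finset (Equiv.Perm (Fin n)) := Finset.univ.filter (· ∈ cycleTypeClass lam) with hs
  have hsc : (s : Set (Equiv.Perm (Fin n))) = cycleTypeClass lam := by
    ext τ
    simp [hs]
  have hρs : ρ ∈ s := by simpa [hs] using hρ
  have hs0 : (s.card : ℝ) ≠ 0 := by
    exact_mod_cast (Finset.card_pos.2 ⟨ρ, hρs⟩).ne'
  have h1 : ∫ ω, ∏ t ∈ T, permIndicator σ (i t, j t) ω ∂μ =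
      ∫ π, Q π ∂(uniformOn (cycleTypeClass lam)) := by
    rw [← hσ.integral_comp (f := Q) (Measurable.of_discrete).aestronglyMeasurable]
    rfl
  have hfin : IsProbabilityMeasure (uniformOn (cycleTypeClass lam)) :=
    hσ.isProbabilityMeasure_iff.1 inferInstance
  have h2 : ∫ π, Q π ∂(uniformOn (cycleTypeClass lam)) = (∑ π ∈ s, Q π) / s.card := by
    rw [integral_fintype Integrable.of_finite, Finset.sum_div, ← Finset.sum_subset
      (Finset.subset_univ s)]
    · refine Finset.sum_congr rfl fun π hπ => ?_
      have h3 : (uniformOn (cycleTypeClass lam)).real {π} = 1 / s.card := by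
        rw [measureReal_def, ← hsc, ← Finset.coe_singleton, uniformOn_apply_finset]
        rw [Finset.inter_singleton_of_mem hπ, Finset.card_singleton]
        simp
      rw [h3, smul_eq_mul]
      ring
    · intro π _ hπ
      have h3 : (uniformOn (cycleTypeClass lam)).real {π} = 0 := by
        rw [measureReal_def, ← hsc, ← Finset.coe_singleton, uniformOn_apply_finset]
        rw [Finset.inter_singleton_of_notMem hπ]
        simp
      rw [h3, zero_smul]
  have h3 := card_mul_sum_conj ρ s
    (fun π => by rw [← mem_cycleTypeClass_iff_isConj hρ, ← hsc, Finset.mem_coe]) Q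
  have h4 : ∀ τ : Equiv.Perm (Fin n), Q (τ⁻¹ * ρ * τ) = edgeCompat i j ρ T τ := by
    intro τ
    refine Finset.prod_congr rfl fun t _ => if_congr ?_ rfl rfl
    rw [Equiv.Perm.mul_apply, Equiv.Perm.mul_apply, Equiv.Perm.inv_eq_iff_eq, eq_comm]
  have h5 : (0 : ℝ) < ((Fintype.card (Fin n))! : ℝ) := by exact_mod_cast Nat.factorial_pos _
  simp only [h4] at h3
  rw [h1, h2, div_eq_div_iff hs0 h5.ne']
  linarith

/-- The constants in the bounds on mixed cumulants. -/
noncomputable def cumulantConst (r : ℕ) : ℝ :=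
  2 ^ ((r * 2) * (r * 2)) * (momentConst ((r * 2) * (r * 2)) +
    2 ^ r * (4 ^ ((r * 2) * (r * 2)) * momentConst ((r * 2) * (r * 2)))) ^ r +
  (1 + 2 ^ r) ^ r * (2 * ((r * 2) * (r * 2)) + 1) ^ (2 * r)

theorem cumulantConst_pos (r : ℕ) : 0 < cumulantConst r := by
  have := one_le_momentConst ((r * 2) * (r * 2))
  unfold cumulantConst
  positivity

theorem abs_mixedCumulant_permIndicator_le (hn : 1 ≤ n)
    (hσ : HasLaw σ (uniformOn (cycleTypeClass lam)) μ) {r : ℕ} (hr : 1 ≤ r)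
    (i j : Fin r → Fin n) :
    |mixedCumulant μ (fun t => permIndicator σ (i t, j t))| ≤ cumulantConst r *
      (1 / (n : ℝ)) ^ ((Finset.univ.image i ∪ Finset.univ.image j).card - 1) := by
  classical
  have hnV : Nonempty (Fin n) := ⟨⟨0, hn⟩⟩
  have hrV : Nonempty (Fin r) := ⟨⟨0, hr⟩⟩
  set m := (Finset.univ.image i ∪ Finset.univ.image j).card - 1 with hm
  have hn0 : (1 : ℝ) ≤ n := by exact_mod_cast hn
  have hqm : (0 : ℝ) ≤ (1 / (n : ℝ)) ^ m := by positivity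
  have hmom := one_le_momentConst ((r * 2) * (r * 2))
  obtain ⟨ρ, hρ⟩ := cycleTypeClass_nonempty hσ
  obtain ⟨κ, hκ, hκu⟩ := mixedCumulant_isCumulant μ (fun t => permIndicator σ (i t, j t))
  have hM : (fun T => ∫ ω, ∏ t ∈ T, permIndicator σ (i t, j t) ω ∂μ) =
      coupledMoment i j ρ Finset.univ := by
    funext T
    rw [coupledMoment_univ, integral_prod_permIndicator hσ hρ]
  have hM0 := coupledMoment_empty i j ρ Finset.univ
  rw [hM] at hκ
  rw [← hκu]
  have hcard : Fintype.card (Constraint (Fin r)) = (r * 2) * (r * 2) := by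
    simp [Constraint]
  unfold cumulantConst
  rw [add_mul]
  -- The threshold makes the union bound give `1/2`. The two summands of `cumulantConst` serve the
  -- two cases.
  by_cases hbig : 2 * ((r * 2) * (r * 2)) ≤ n
  · choose κ' hκ' using fun Γ =>
      exists_isCumulant (coupledMoment i j ρ Γ) (coupledMoment_empty i j ρ Γ)
    have h1 := abs_coupledCumulant_le i j ρ (by rwa [hcard, Fintype.card_fin]) hκ' Finset.univ
    rw [(hκ' Finset.univ).unique hκ hM0 Finset.univ_nonempty, hcard, Fintype.card_fin,
      Fintype.card_fin] at h1
    refine h1.trans (le_add_of_nonneg_right ?_)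
    positivity
  · have hb : ∀ T, |coupledMoment i j ρ Finset.univ T| ≤ 1 := by
      intro T
      have h5 : (0 : ℝ) < ((Fintype.card (Fin n))! : ℝ) := by exact_mod_cast Nat.factorial_pos _
      rw [coupledMoment_univ, abs_div, abs_of_pos h5, div_le_one h5]
      refine (Finset.abs_sum_le_sum_abs _ _).trans ?_
      have h6 : ∀ τ : Equiv.Perm (Fin n), |edgeCompat i j ρ T τ| ≤ 1 := fun τ => by
        rw [edgeCompat_eq]
        split_ifs <;> simp
      refine (Finset.sum_le_sum fun τ _ => h6 τ).trans_eq ?_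
      rw [Finset.sum_const, Finset.card_univ, Fintype.card_perm, nsmul_eq_mul, mul_one]
    have h1 := hκ.abs_le hM0 hb
    rw [Fintype.card_fin] at h1
    -- Here `n` is bounded in terms of `r` and the exponent is at most `2 * r`, so the decay factor
    -- is bounded below.
    have h2 : (1 : ℝ) ≤ (2 * ((r * 2) * (r * 2)) + 1) ^ (2 * r) * (1 / (n : ℝ)) ^ m := by
      have h3 : m ≤ 2 * r := by
        have h4 := Finset.card_union_le (Finset.univ.image i) (Finset.univ.image j)
        have h5 : (Finset.univ.image i).card ≤ r :=
          Finset.card_image_le.trans_eq (by rw [Finset.card_univ, Fintype.card_fin])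
        have h6 : (Finset.univ.image j).card ≤ r :=
          Finset.card_image_le.trans_eq (by rw [Finset.card_univ, Fintype.card_fin])
        lia
      have h4 : (n : ℝ) ≤ 2 * ((r * 2) * (r * 2)) + 1 := by
        have : n ≤ 2 * ((r * 2) * (r * 2)) + 1 := by lia
        exact_mod_cast this
      have h5 : (n : ℝ) ^ m ≤ (2 * ((r * 2) * (r * 2)) + 1) ^ (2 * r) :=
        (pow_le_pow_right₀ hn0 h3).trans (by gcongr)
      rw [one_div, inv_pow, ← div_eq_mul_inv, le_div_iff₀ (by positivity), one_mul]
      exact h5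
    refine h1.trans (le_trans ?_ (le_add_of_nonneg_left (by positivity)))
    rw [mul_assoc]
    exact le_mul_of_one_le_right (by positivity) h2

end Cumulant

/-! ### Heavy spanning trees -/

section SpanningTree

/-- Rank-nullity for the coboundary map `d`: its rank is at most the number of edges, and its kernel
consists of functions constant on components. -/
theorem SimpleGraph.card_le_card_edgeFinset_add_card_connectedComponent {V : Type*} [Fintype V]
    (G : SimpleGraph V) [Fintype G.edgeSet] :
    Fintype.card V ≤ G.edgeFinset.card + Nat.card G.ConnectedComponent := by
  classical
  let d : (V → ℚ) →ₗ[ℚ] (G.edgeFinset → ℚ) :=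
    LinearMap.funLeft ℚ ℚ (fun e : G.edgeFinset => (Quot.out e.1).1) -
      LinearMap.funLeft ℚ ℚ (fun e : G.edgeFinset => (Quot.out e.1).2)
  let c : LinearMap.ker d →ₗ[ℚ] (G.ConnectedComponent → ℚ) :=
    (LinearMap.funLeft ℚ ℚ fun C : G.ConnectedComponent => Quot.out C).comp
      (LinearMap.ker d).subtype
  have hadj : ∀ ψ ∈ LinearMap.ker d, ∀ x y, G.Adj x y → ψ x = ψ y := by
    intro ψ hps x y hxy
    have h1 := congrFun (LinearMap.mem_ker.1 hps)
      ⟨s(x, y), SimpleGraph.mem_edgeFinset.2 hxy⟩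
    have h2 : ψ (Quot.out s(x, y)).1 = ψ (Quot.out s(x, y)).2 := sub_eq_zero.1 h1
    have h3 : s((Quot.out s(x, y)).1, (Quot.out s(x, y)).2) = s(x, y) := Quot.out_eq _
    rcases Sym2.eq_iff.1 h3 with ⟨h4, h5⟩ | ⟨h4, h5⟩
    · rwa [h4, h5] at h2
    · rw [h4, h5] at h2
      exact h2.symm
  have hreach : ∀ ψ ∈ LinearMap.ker d, ∀ x y, G.Reachable x y → ψ x = ψ y := by
    rintro ψ hps x y ⟨p⟩
    induction p with
    | nil => rfl
    | cons h _ ih => exact (hadj ψ hps _ _ h).trans ih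
  have hc : Function.Injective c := by
    rw [← LinearMap.ker_eq_bot, LinearMap.ker_eq_bot']
    rintro ⟨ψ, hps⟩ h0
    ext x
    have h1 : ψ (Quot.out (G.connectedComponentMk x)) = 0 := congrFun h0 (G.connectedComponentMk x)
    have h2 : G.Reachable (Quot.out (G.connectedComponentMk x)) x :=
      SimpleGraph.ConnectedComponent.exact (Quot.out_eq _)
    exact (hreach ψ hps _ _ h2).symm.trans h1
  have h1 := LinearMap.finrank_le_finrank_of_injective hc
  have h2 := LinearMap.finrank_range_add_finrank_ker d
  have h3 := Submodule.finrank_le (LinearMap.range d)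
  rw [Module.finrank_fintype_fun_eq_card] at h1 h2 h3
  rw [Fintype.card_coe] at h3
  rw [Nat.card_eq_fintype_card]
  lia

/-- A weighted graph whose weights are at least `q`, and at least `1` on the edges of `G`, has a
spanning tree with at most `c - 1` edges outside of `G`, where `c` is the number of connected
components of `G`. -/
theorem WeightedGraph.pow_le_maxSpanningTreeWeight {V : Type*} [Fintype V] [Nonempty V]
    (L : WeightedGraph V) (G : SimpleGraph V) {q : ℝ} (hq : 0 ≤ q) (hq1 : q ≤ 1)
    (hL : ∀ u v, q ≤ L.weight u v) (hG : ∀ u v, G.Adj u v → 1 ≤ L.weight u v) :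
    q ^ (Nat.card G.ConnectedComponent - 1) ≤ L.maxSpanningTreeWeight := by
  classical
  -- Extend a spanning forest `F` of `G` to a spanning tree `T`. Since `T` has `card V - 1` edges
  -- and `F` at least `card V - c`, at most `c - 1` edges of `T` lie outside `F`.
  obtain ⟨F, hFG, hF, hreach⟩ := G.exists_isAcyclic_reachable_eq_le
  obtain ⟨T, hFT, -, hT⟩ :=
    (SimpleGraph.connected_top (V := V)).exists_isTree_le_of_le_of_isAcyclic le_top hF
  have hcomp : Nat.card F.ConnectedComponent = Nat.card G.ConnectedComponent := by
    unfold SimpleGraph.ConnectedComponent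
    rw [hreach]
  have h1 := F.card_le_card_edgeFinset_add_card_connectedComponent
  have h2 := hT.card_edgeFinset
  have hsub : F.edgeFinset ⊆ T.edgeFinset := SimpleGraph.edgeFinset_mono hFT
  have h3 := Finset.card_sdiff_add_card_eq_card hsub
  have h4 : q ^ (Nat.card G.ConnectedComponent - 1) ≤ ∏ e ∈ T.edgeFinset, L.edgeWeight e := by
    rw [← Finset.prod_sdiff hsub]
    have h5 : q ^ (T.edgeFinset \ F.edgeFinset).card ≤
        ∏ e ∈ T.edgeFinset \ F.edgeFinset, L.edgeWeight e := by
      rw [← Finset.prod_const]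
      refine Finset.prod_le_prod (fun _ _ => hq) fun e _ => ?_
      induction e using Sym2.ind with
      | _ u v => exact hL u v
    have h6 : 1 ≤ ∏ e ∈ F.edgeFinset, L.edgeWeight e := by
      rw [← Finset.prod_const_one (s := F.edgeFinset)]
      refine Finset.prod_le_prod (fun _ _ => zero_le_one) fun e he => ?_
      induction e using Sym2.ind with
      | _ u v => exact hG u v (hFG (SimpleGraph.mem_edgeFinset.1 he))
    calc q ^ (Nat.card G.ConnectedComponent - 1)
        ≤ q ^ (T.edgeFinset \ F.edgeFinset).card :=
          pow_le_pow_of_le_one hq hq1 (by lia)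
      _ ≤ ∏ e ∈ T.edgeFinset \ F.edgeFinset, L.edgeWeight e := h5
      _ ≤ _ := le_mul_of_one_le_right ((by positivity : (0 : ℝ) ≤ q ^ _).trans h5) h6
  refine h4.trans ?_
  unfold WeightedGraph.maxSpanningTreeWeight
  refine le_trans ?_ (le_ciSup (Set.finite_range _).bddAbove ⟨T, hT⟩)
  refine le_of_eq (Finset.prod_congr ?_ fun _ _ => rfl)
  ext e
  simp

/-- The graph on the elements of a multiset of pairs in which intersecting pairs are adjacent. -/
def intersectionGraph {n : ℕ} (α : Multiset (Fin n × Fin n)) : SimpleGraph α.toFinset where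
  Adj p q := p ≠ q ∧ ¬ Disjoint ({p.1.1, p.1.2} : Finset (Fin n)) {q.1.1, q.1.2}
  symm := ⟨fun _ _ h => ⟨h.1.symm, fun h' => h.2 h'.symm⟩⟩
  loopless := ⟨fun _ h => h.1 rfl⟩

/-- Send a vertex to any pair containing it. All pairs through one vertex intersect, so this
descends to components, and it is surjective because every pair contains a vertex. -/
theorem card_connectedComponent_intersectionGraph_le {n : ℕ} (α : Multiset (Fin n × Fin n)) :
    Nat.card (intersectionGraph α).ConnectedComponent ≤ pairCC α := by
  classical
  have hex : ∀ x : pairSupport α, ∃ p : α.toFinset,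
      x.1 ∈ ({p.1.1, p.1.2} : Finset (Fin n)) := by
    rintro ⟨x, hx⟩
    rw [pairSupport, Finset.mem_union, Finset.mem_image, Finset.mem_image] at hx
    rcases hx with ⟨p, hp, rfl⟩ | ⟨p, hp, rfl⟩
    · exact ⟨⟨p, hp⟩, by simp⟩
    · exact ⟨⟨p, hp⟩, by simp⟩
  choose g hg using hex
  have hcomp : ∀ (x : pairSupport α) (p : α.toFinset),
      x.1 ∈ ({p.1.1, p.1.2} : Finset (Fin n)) →
        (intersectionGraph α).connectedComponentMk (g x) =
          (intersectionGraph α).connectedComponentMk p := by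
    intro x p hp
    by_cases h : g x = p
    · rw [h]
    · exact SimpleGraph.ConnectedComponent.connectedComponentMk_eq_of_adj
        ⟨h, Finset.not_disjoint_iff.2 ⟨x.1, hg x, hp⟩⟩
  have hadj : ∀ x y : pairSupport α, (pairGraph α).Adj x y →
      (intersectionGraph α).connectedComponentMk (g x) =
        (intersectionGraph α).connectedComponentMk (g y) := by
    intro x y hxy
    rw [pairGraph, SimpleGraph.fromRel_adj] at hxy
    rcases hxy.2 with h | h
    · rw [hcomp x ⟨_, Multiset.mem_toFinset.2 h⟩ (by simp),
        hcomp y ⟨_, Multiset.mem_toFinset.2 h⟩ (by simp)]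
    · rw [hcomp x ⟨_, Multiset.mem_toFinset.2 h⟩ (by simp),
        hcomp y ⟨_, Multiset.mem_toFinset.2 h⟩ (by simp)]
  let f : (pairGraph α).ConnectedComponent → (intersectionGraph α).ConnectedComponent :=
    SimpleGraph.ConnectedComponent.lift
      (fun x => (intersectionGraph α).connectedComponentMk (g x)) (by
        intro x y p hp
        clear hp
        induction p with
        | nil => rfl
        | cons h _ ih => exact (hadj _ _ h).trans ih)
  refine Nat.card_le_card_of_surjective f fun C => ?_
  induction C using SimpleGraph.ConnectedComponent.ind with
  | _ p =>
    have hx : p.1.1 ∈ pairSupport α :=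
      Finset.mem_union_left _ (Finset.mem_image_of_mem _ p.2)
    exact ⟨(pairGraph α).connectedComponentMk ⟨p.1.1, hx⟩, hcomp _ p (by simp)⟩

/-- `Ψ(α) * M(L[α])` is at least `n ^ (1 - #S(α))`. -/
theorem zpow_le_pairPsi_mul_maxSpanningTreeWeight {n : ℕ} (hn : 1 ≤ n)
    {α : Multiset (Fin n × Fin n)} (hα : α.toFinset.Nonempty) :
    (n : ℝ) ^ ((1 : ℤ) - ((pairSupport α).card : ℤ)) ≤
      pairPsi n α * ((conjugacyGraph n).induce α.toFinset).maxSpanningTreeWeight := by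
  have hn1 : (1 : ℝ) ≤ n := by exact_mod_cast hn
  have hn0 : (n : ℝ) ≠ 0 := by positivity
  have hq0 : (0 : ℝ) ≤ 1 / n := by positivity
  have hq1 : 1 / (n : ℝ) ≤ 1 := by
    rw [div_le_one (by linarith)]
    exact hn1
  have hne : Nonempty α.toFinset := hα.to_subtype
  have h1 := WeightedGraph.pow_le_maxSpanningTreeWeight
    ((conjugacyGraph n).induce α.toFinset) (intersectionGraph α) hq0 hq1
    (fun u v => by
      change _ ≤ (conjugacyGraph n).weight u v
      unfold conjugacyGraph
      dsimp only
      split_ifs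
      · exact le_rfl
      · exact hq1)
    (fun u v huv => by
      change _ ≤ (conjugacyGraph n).weight u v
      unfold conjugacyGraph
      dsimp only
      rw [if_neg huv.2])
  have h2 := card_connectedComponent_intersectionGraph_le α
  have h3 : 1 ≤ pairCC α := by
    refine le_trans ?_ h2
    have : Nonempty (intersectionGraph α).ConnectedComponent :=
      hne.map (intersectionGraph α).connectedComponentMk
    exact Nat.card_pos
  have h4 : (1 / (n : ℝ)) ^ (pairCC α - 1) ≤
      ((conjugacyGraph n).induce α.toFinset).maxSpanningTreeWeight :=
    (pow_le_pow_of_le_one hq0 hq1 (by lia)).trans h1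
  have h5 : (n : ℝ) ^ ((1 : ℤ) - ((pairSupport α).card : ℤ)) =
      pairPsi n α * (1 / (n : ℝ)) ^ (pairCC α - 1) := by
    rw [pairPsi, one_div, inv_pow, ← zpow_natCast, ← zpow_neg, ← zpow_add₀ hn0]
    congr 1
    push_cast [h3]
    ring
  rw [h5]
  exact mul_le_mul_of_nonneg_left h4 (by unfold pairPsi; positivity)

end SpanningTree

/-! ### The main theorem -/

theorem theorem3 :
    ∃ C : ℕ → ℝ, (∀ r : ℕ, 1 ≤ r → 0 < C r) ∧
      ∀ (n : ℕ), 1 ≤ n → ∀ (lam : n.Partition)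
        {Ω : Type*} [MeasurableSpace Ω] (μ : Measure Ω) [IsProbabilityMeasure μ]
        (σ : Ω → Equiv.Perm (Fin n)), HasLaw σ (uniformOn (cycleTypeClass lam)) μ →
        IsWeightedDependencyGraph (pairPsi n) C (conjugacyGraph n) (permIndicator σ) μ ∧
        ∀ (r : ℕ), 1 ≤ r → ∀ (i j : Fin r → Fin n),
          |mixedCumulant μ (fun t => permIndicator σ (i t, j t))| ≤
            C r * (n : ℝ) ^
              ((1 : ℤ) - ((Finset.univ.image i ∪ Finset.univ.image j).card : ℤ)) := by
  refine ⟨cumulantConst, fun r _ => cumulantConst_pos r, ?_⟩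
  intro n hn lam Ω _ μ _ σ hσ
  have key : ∀ (r : ℕ), 1 ≤ r → ∀ (i j : Fin r → Fin n),
      |mixedCumulant μ (fun t => permIndicator σ (i t, j t))| ≤
        cumulantConst r * (n : ℝ) ^
          ((1 : ℤ) - ((Finset.univ.image i ∪ Finset.univ.image j).card : ℤ)) := by
    intro r hr i j
    refine (abs_mixedCumulant_permIndicator_le hn hσ hr i j).trans_eq ?_
    have hcard : 1 ≤ (Finset.univ.image i ∪ Finset.univ.image j).card :=
      Finset.card_pos.2 ⟨i ⟨0, hr⟩,
        Finset.mem_union_left _ (Finset.mem_image_of_mem i (Finset.mem_univ _))⟩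
    rw [one_div, inv_pow, ← zpow_natCast, ← zpow_neg]
    congr 2
    push_cast [hcard]
    ring
  refine ⟨?_, key⟩
  rintro r hr v U rfl
  have hne : (Multiset.map v Finset.univ.val).toFinset.Nonempty :=
    ⟨v ⟨0, hr⟩, by simp⟩
  have hsupp : pairSupport (Multiset.map v Finset.univ.val) =
      Finset.univ.image (fun t => (v t).1) ∪ Finset.univ.image (fun t => (v t).2) := by
    ext x
    simp [pairSupport]
  -- The dependency-graph bound is the weaker of the two: its right-hand side dominates `n ^ (1 -
  -- #S)`.
  have h1 := zpow_le_pairPsi_mul_maxSpanningTreeWeight hn hne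
  rw [hsupp] at h1
  rw [mul_assoc]
  exact (key r hr (fun t => (v t).1) fun t => (v t).2).trans
    (mul_le_mul_of_nonneg_left h1 (cumulantConst_pos r).le)
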